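/- Let $\mathbb F$ be an algebraically closed field of characteristic $0$. Let $\mathfrak{BI}$ (the universal Bannai–Ito algebra) be the unital associative $\mathbb F$-algebra with generators $X,Y,Z$ and relations asserting that each of $$\kappa=\{X,Y\}-Z,\qquad \lambda=\{Y,Z\}-X,\qquad \mu=\{Z,X\}-Y$$ commutes with $X,Y,Z$, where $\{A,B\}=AB+BA$. Let $d\ge 1$ be an odd integer. For $a,b,c\in\mathbb F$ let $E_d(a,b,c)$ be the $(d+1)$-dimensional $\mathfrak{BI}$-module with basis $v_0,\dots,v_d$ such that $$Xv_i=\theta_iv_i+v_{i+1}\ (0\le i<d),\quad Xv_d=\theta_dv_d,\qquad Yv_0=\theta_0^*v_0,\quad Yv_i=\theta_i^*v_i+\varphi_iv_{i-1}\ (1\le i\le d),$$ where $$\theta_i=\frac{(-1)^i(2a-d+2i)}2,\qquad \theta_i^*=\frac{(-1)^i(2b-d+2i)}2,\qquad \varphi_i=\begin{cases} i(d-i+1)& i\text{ even},\\ c^2-\frac{(2a+2b-d+2i-1)^2}{4}& i\text{ odd},\end{cases}$$ and such that $\kappa,\lambda,\mu$ act as the scalars $$c^2-a^2-b^2+\tfrac{(d+1)^2}4,\qquad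 a^2-b^2-c^2+\tfrac{(d+1)^2}4,\qquad b^2-c^2-a^2+\tfrac{(d+1)^2}4$$ respectively. For $(\varepsilon,\varepsilon')\in\{\pm1\}^2$ and a $\mathfrak{BI}$-module $V$ let $V^{(\varepsilon,\varepsilon')}$ be the module obtained by twisting $V$ by the automorphism $X\mapsto\varepsilon X$, $Y\mapsto\varepsilon'Y$, $Z\mapsto\varepsilon\varepsilon'Z$ of $\mathfrak{BI}$. Let $\mathbf{EM}_d$ be the set of isomorphism classes of irreducible $\mathfrak{BI}$-modules of dimension $d+1$, and let $\mathbf{EP}_d$ be the set of all $(a,b,c)\in\mathbb F^3$ with $$a+b+c,\ -a+b+c,\ a-b+c,\ a+b-c\ \notin\ \Big\{\tfrac{d-1}{2}-i \;\Big|\; i=0,2,\dots,d-1\Big\}.$$ The group $\{\pm1\}^3$ acts on $\mathbf{EP}_d$ by changing the signs of $a$, $b$, $c$; let $[a,b,c]$ denote the orbit of $(a,b,c)$ and $\mathbf{EP}_d/\{\pm1\}^3$ the set of orbits. **Theorem.** There exists a bijection $\mathcal E:\{\pm1\}^2\times \mathbf{EP}_d/\{\pm1\}^3\to\mathbf{EM}_d$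 given by $$((\varepsilon,\varepsilon'),[a,b,c])\ \mapsto\ \text{the isomorphism class of } E_d(a,b,c)^{(\varepsilon,\varepsilon')}$$ for all $(\varepsilon,\varepsilon')\in\{\pm1\}^2$ and all $[a,b,c]\in\mathbf{EP}_d/\{\pm1\}^3$. -/

import Mathlib

open CategoryTheory

universe u

/-! ### The universal Bannai--Ito algebra -/

/-- The three generators of the universal Bannai--Ito algebra. -/
inductive BIGen : Type
  | X | Y | Z

namespace BI

/-- The free generators `X`, `Y`, `Z`. -/
abbrev free (F : Type u) [Field F] (g : BIGen) : FreeAlgebra F BIGen := FreeAlgebra.ι F g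

/-- The anticommutator `{x, y} = xy + yx`. -/
def anti {A : Type u} [Ring A] (x y : A) : A := x * y + y * x

/-- The defining relations: each of `{X,Y} - Z`, `{Y,Z} - X`, `{Z,X} - Y` commutes with
each of the generators `X`, `Y`, `Z`. -/
inductive Rel (F : Type u) [Field F] : FreeAlgebra F BIGen → FreeAlgebra F BIGen → Prop
  | kappa (g : BIGen) : Rel F
      ((anti (free F .X) (free F .Y) - free F .Z) * free F g)
      (free F g * (anti (free F .X) (free F .Y) - free F .Z))
  | lambda (g : BIGen) : Rel F
      ((anti (free F .Y) (free F .Z) - free F .X) * free F g)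
      (free F g * (anti (free F .Y) (free F .Z) - free F .X))
  | mu (g : BIGen) : Rel F
      ((anti (free F .Z) (free F .X) - free F .Y) * free F g)
      (free F g * (anti (free F .Z) (free F .X) - free F .Y))

end BI

/-- The universal Bannai--Ito algebra over `F`: the unital associative `F`-algebra with generators
`X`, `Y`, `Z` and the relations `BI.Rel`. -/
def BI (F : Type u) [Field F] : Type u := RingQuot (BI.Rel F)

instance BI.instRing (F : Type u) [Field F] : Ring (BI F) :=
  inferInstanceAs (Ring (RingQuot (BI.Rel F)))

instance BI.instAlgebra (F : Type u) [Field F] : Algebra F (BI F) :=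
  inferInstanceAs (Algebra F (RingQuot (BI.Rel F)))

namespace BI

section Algebra

variable (F : Type u) [Field F]

/-- The quotient map from the free algebra. -/
def mk : FreeAlgebra F BIGen →ₐ[F] BI F := RingQuot.mkAlgHom F (Rel F)

/-- The image of a generator in the universal Bannai--Ito algebra. -/
def gen (g : BIGen) : BI F := mk F (free F g)

/-- The universal property: three elements of an `F`-algebra that satisfy the defining relations
give an algebra homomorphism. -/
def lift {F : Type u} [Field F] {A : Type u} [Ring A] [Algebra F A] (f : BIGen → A)
    (h₁ : ∀ g, Commute (anti (f .X) (f .Y) - f .Z) (f g))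
    (h₂ : ∀ g, Commute (anti (f .Y) (f .Z) - f .X) (f g))
    (h₃ : ∀ g, Commute (anti (f .Z) (f .X) - f .Y) (f g)) : BI F →ₐ[F] A :=
  RingQuot.liftAlgHom F ⟨FreeAlgebra.lift F f, by
    rintro _ _ (g | g | g)
    · simpa [anti, free] using (h₁ g).eq
    · simpa [anti, free] using (h₂ g).eq
    · simpa [anti, free] using (h₃ g).eq⟩

theorem lift_gen {F : Type u} [Field F] {A : Type u} [Ring A] [Algebra F A] (f : BIGen → A)
    (h₁ : ∀ g, Commute (anti (f .X) (f .Y) - f .Z) (f g))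
    (h₂ : ∀ g, Commute (anti (f .Y) (f .Z) - f .X) (f g))
    (h₃ : ∀ g, Commute (anti (f .Z) (f .X) - f .Y) (f g)) (g : BIGen) :
    lift (F := F) f h₁ h₂ h₃ (gen F g) = f g := by
  exact (RingQuot.liftAlgHom_mkAlgHom_apply F _ _ _).trans (FreeAlgebra.lift_ι_apply _ _)

theorem hom_ext {F : Type u} [Field F] {A : Type u} [Ring A] [Algebra F A] {φ ψ : BI F →ₐ[F] A}
    (h : ∀ g, φ (gen F g) = ψ (gen F g)) : φ = ψ := by
  apply RingQuot.ringQuot_ext'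
  apply FreeAlgebra.hom_ext
  funext g
  exact h g

theorem mk_rel {p q : FreeAlgebra F BIGen} (h : Rel F p q) : mk F p = mk F q :=
  RingQuot.mkAlgHom_rel F h

theorem commute_kappa (g : BIGen) :
    Commute (anti (gen F .X) (gen F .Y) - gen F .Z) (gen F g) := by
  have h := mk_rel F (Rel.kappa (F := F) g)
  simp only [anti, map_sub, map_mul, map_add] at h
  exact h

theorem commute_lambda (g : BIGen) :
    Commute (anti (gen F .Y) (gen F .Z) - gen F .X) (gen F g) := by
  have h := mk_rel F (Rel.lambda (F := F) g)
  simp only [anti, map_sub, map_mul, map_add] at h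
  exact h

theorem commute_mu (g : BIGen) :
    Commute (anti (gen F .Z) (gen F .X) - gen F .Y) (gen F g) := by
  have h := mk_rel F (Rel.mu (F := F) g)
  simp only [anti, map_sub, map_mul, map_add] at h
  exact h

/-! ### The action of `{±1}²` on the algebra and twisted modules -/

/-- The sign by which `(ε, ε')` multiplies each generator:
`X ↦ ε X`, `Y ↦ ε' Y`, `Z ↦ ε ε' Z`. -/
def genSign (ε ε' : ℤˣ) : BIGen → ℤˣ
  | .X => ε
  | .Y => ε'
  | .Z => ε * ε'

/-- The action of `(ε, ε')` on the algebra, as an algebra homomorphism. -/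
def signHom (ε ε' : ℤˣ) : BI F →ₐ[F] BI F :=
  lift (fun g => ((genSign ε ε' g : ℤˣ) : ℤ) • gen F g)
    (by
      intro g
      have e : anti ((ε : ℤ) • gen F .X) ((ε' : ℤ) • gen F .Y) - ((ε * ε' : ℤˣ) : ℤ) • gen F .Z
          = ((ε * ε' : ℤˣ) : ℤ) • (anti (gen F .X) (gen F .Y) - gen F .Z) := by
        rcases Int.units_eq_one_or ε with rfl | rfl <;>
          rcases Int.units_eq_one_or ε' with rfl | rfl <;> simp [anti] <;> abel
      simp only [genSign] at e ⊢
      rw [e]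
      exact ((commute_kappa F g).smul_left _).smul_right _)
    (by
      intro g
      have e : anti ((ε' : ℤ) • gen F .Y) (((ε * ε' : ℤˣ) : ℤ) • gen F .Z) - (ε : ℤ) • gen F .X
          = (ε : ℤ) • (anti (gen F .Y) (gen F .Z) - gen F .X) := by
        rcases Int.units_eq_one_or ε with rfl | rfl <;>
          rcases Int.units_eq_one_or ε' with rfl | rfl <;> simp [anti] <;> abel
      simp only [genSign] at e ⊢
      rw [e]
      exact ((commute_lambda F g).smul_left _).smul_right _)
    (by
      intro g
      have e : anti (((ε * ε' : ℤˣ) : ℤ) • gen F .Z) ((ε : ℤ) • gen F .X) - (ε' : ℤ) • gen F .Y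
          = (ε' : ℤ) • (anti (gen F .Z) (gen F .X) - gen F .Y) := by
        rcases Int.units_eq_one_or ε with rfl | rfl <;>
          rcases Int.units_eq_one_or ε' with rfl | rfl <;> simp [anti] <;> abel
      simp only [genSign] at e ⊢
      rw [e]
      exact ((commute_mu F g).smul_left _).smul_right _)

theorem signHom_gen (ε ε' : ℤˣ) (g : BIGen) :
    signHom F ε ε' (gen F g) = ((genSign ε ε' g : ℤˣ) : ℤ) • gen F g :=
  lift_gen _ _ _ _ g

theorem signHom_comp_self (ε ε' : ℤˣ) :
    (signHom F ε ε').comp (signHom F ε ε') = AlgHom.id F (BI F) := by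
  apply hom_ext
  intro g
  rw [AlgHom.comp_apply, signHom_gen, map_zsmul, signHom_gen, smul_smul, ← Units.val_mul,
    Int.units_mul_self]
  simp

/-- The automorphism by which `(ε, ε') ∈ {±1}²` acts on the universal Bannai--Ito algebra. -/
def signAut (ε ε' : ℤˣ) : BI F ≃ₐ[F] BI F :=
  AlgEquiv.ofAlgHom (signHom F ε ε') (signHom F ε ε') (signHom_comp_self F ε ε')
    (signHom_comp_self F ε ε')

/-- The module `V^(ε,ε')`, in which `x` acts as the image of `x` under `(ε, ε')` acts on `V`. -/
noncomputable def twist {F : Type u} [Field F] (ε ε' : ℤˣ) (V : ModuleCat.{u} (BI F)) :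
    ModuleCat.{u} (BI F) :=
  (ModuleCat.restrictScalars (signAut F ε ε' : BI F →+* BI F)).obj V

/-- The dimension over `F` of a module over the universal Bannai--Ito algebra; `F` acts through
the structure map of the algebra. -/
noncomputable def dim {F : Type u} [Field F] (V : ModuleCat.{u} (BI F)) : ℕ :=
  letI : Module F V := ModuleCat.moduleOfAlgebraModule V
  Module.finrank F V

/-- The isomorphism classes of modules over the universal Bannai--Ito algebra. -/
abbrev IsoClasses : Type (u + 1) := Quotient (isIsomorphicSetoid (ModuleCat.{u} (BI F)))

/-- The isomorphism class of a module. -/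
def isoClass {F : Type u} [Field F] (V : ModuleCat.{u} (BI F)) : IsoClasses F :=
  Quotient.mk (isIsomorphicSetoid (ModuleCat.{u} (BI F))) V

/-- The set of all isomorphism classes of irreducible modules that have dimension `d + 1`. -/
def EM (d : ℕ) : Set (IsoClasses F) :=
  {C | ∃ V : ModuleCat.{u} (BI F), IsSimpleModule (BI F) V ∧ dim V = d + 1 ∧ C = isoClass V}

end Algebra

/-! ### The modules `E_d(a,b,c)` -/

section EModule

variable {F : Type u} [Field F]

/-- `theta d a i = (-1)^i (2a - d + 2i) / 2`. -/
def theta (d : ℕ) (a : F) (i : ℕ) : F := (-1) ^ i * (2 * a - d + 2 * i) / 2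

/-- `phi_i`, equal to `i (d - i + 1)` for even `i` and to
`c² - (2a + 2b - d + 2i - 1)² / 4` for odd `i`. -/
def phi (d : ℕ) (a b c : F) (i : ℕ) : F :=
  if Even i then (i : F) * (d - i + 1)
  else c ^ 2 - (2 * a + 2 * b - d + 2 * i - 1) ^ 2 / 4

/-- The matrix of `X` on `E_d(a,b,c)`: diagonal entries `theta_i`, subdiagonal entries `1`. -/
def matX (d : ℕ) (a : F) : Matrix (Fin (d + 1)) (Fin (d + 1)) F :=
  Matrix.of fun i j =>
    if (i : ℕ) = j then theta d a i else if (i : ℕ) = j + 1 then 1 else 0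

/-- The matrix of `Y` on `E_d(a,b,c)`: diagonal entries `theta*_i`, and superdiagonal entry `phi_j`
in position `(j - 1, j)`. -/
def matY (d : ℕ) (a b c : F) : Matrix (Fin (d + 1)) (Fin (d + 1)) F :=
  Matrix.of fun i j =>
    if (i : ℕ) = j then theta d b i else if (j : ℕ) = i + 1 then phi d a b c j else 0

/-- The scalar by which `{X,Y} - Z` acts on `E_d(a,b,c)`. -/
def kappaE (d : ℕ) (a b c : F) : F := c ^ 2 - a ^ 2 - b ^ 2 + ((d : F) + 1) ^ 2 / 4

/-- The scalar by which `{Y,Z} - X` acts on `E_d(a,b,c)`. -/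
def lambdaE (d : ℕ) (a b c : F) : F := a ^ 2 - b ^ 2 - c ^ 2 + ((d : F) + 1) ^ 2 / 4

/-- The scalar by which `{Z,X} - Y` acts on `E_d(a,b,c)`. -/
def muE (d : ℕ) (a b c : F) : F := b ^ 2 - c ^ 2 - a ^ 2 + ((d : F) + 1) ^ 2 / 4

/-- The matrices of `X`, `Y` and `Z = {X,Y} - kappa` on `E_d(a,b,c)`. -/
def matE (d : ℕ) (a b c : F) : BIGen → Matrix (Fin (d + 1)) (Fin (d + 1)) F
  | .X => matX d a
  | .Y => matY d a b c
  | .Z => anti (matX d a) (matY d a b c) - Matrix.scalar _ (kappaE d a b c)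

/-- Restriction of a sequence to its first `d + 1` terms. -/
def res (d : ℕ) (g : ℕ → F) : Fin (d + 1) → F := fun i => g i

/-- `matX` on sequences. -/
def seqX (d : ℕ) (a : F) (g : ℕ → F) : ℕ → F :=
  fun n => theta d a n * g n + if n = 0 then 0 else g (n - 1)

/-- `matY` on sequences. -/
def seqY (d : ℕ) (a b c : F) (g : ℕ → F) : ℕ → F :=
  fun n => theta d b n * g n + phi d a b c (n + 1) * g (n + 1)

theorem matX_res (d : ℕ) (a : F) (g : ℕ → F) :
    (matX d a).mulVec (res d g) = res d (seqX d a g) := by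
  funext i
  have key : ∀ j : Fin (d + 1), matX d a i j * res d g j =
      (if j = i then theta d a i * g i else 0) +
        (if (i : ℕ) = j + 1 then g j else 0) := by
    intro j
    by_cases h : j = i
    · subst h; simp [matX, res]
    · have h' : ¬ (i : ℕ) = j := fun e => h (Fin.ext e.symm)
      simp [matX, res, h, h']
  simp only [Matrix.mulVec, dotProduct, key, Finset.sum_add_distrib]
  simp only [Finset.sum_ite_eq', Finset.mem_univ, if_true, res, seqX]
  congr 1
  obtain ⟨i, hi⟩ := i
  cases i with
  | zero => simp
  | succ n =>
    rw [Finset.sum_eq_single (⟨n, by omega⟩ : Fin (d + 1))]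
    · simp
    · intro j _ hj
      rw [if_neg]
      intro e
      apply hj
      apply Fin.ext
      simp at e ⊢
      omega
    · simp

theorem phi_last (d : ℕ) (hd : Odd d) (a b c : F) : phi d a b c (d + 1) = 0 := by
  have : Even (d + 1) := hd.add_one
  simp [phi, this]

theorem matY_res (d : ℕ) (hd : Odd d) (a b c : F) (g : ℕ → F) :
    (matY d a b c).mulVec (res d g) = res d (seqY d a b c g) := by
  funext i
  have key : ∀ j : Fin (d + 1), matY d a b c i j * res d g j =
      (if j = i then theta d b i * g i else 0) +
        (if (j : ℕ) = i + 1 then phi d a b c j * g j else 0) := by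
    intro j
    by_cases h : j = i
    · subst h; simp [matY, res]
    · have h' : ¬ (i : ℕ) = j := fun e => h (Fin.ext e.symm)
      simp [matY, res, h, h']
  simp only [Matrix.mulVec, dotProduct, key, Finset.sum_add_distrib]
  simp only [Finset.sum_ite_eq', Finset.mem_univ, if_true, res, seqY]
  congr 1
  obtain ⟨i, hi⟩ := i
  by_cases hl : i = d
  · subst hl
    rw [phi_last i hd, zero_mul]
    apply Finset.sum_eq_zero
    intro j _
    rw [if_neg]
    have := j.2
    simp
    omega
  · rw [Finset.sum_eq_single (⟨i + 1, by omega⟩ : Fin (d + 1))]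
    · simp
    · intro j _ hj
      rw [if_neg]
      intro e
      apply hj
      apply Fin.ext
      simpa using e
    · simp

theorem exists_res (d : ℕ) (v : Fin (d + 1) → F) : ∃ g : ℕ → F, v = res d g :=
  ⟨fun n => if h : n < d + 1 then v ⟨n, h⟩ else 0, by
    funext i
    have := i.2
    simp only [res, dif_pos this]⟩

theorem theta_even (d : ℕ) (a : F) (k : ℕ) : theta d a (2 * k) = (2 * a - d + 4 * k) / 2 := by
  simp only [theta, pow_mul]; push_cast; ring

theorem theta_odd (d : ℕ) (a : F) (k : ℕ) :
    theta d a (2 * k + 1) = -(2 * a - d + 4 * k + 2) / 2 := by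
  simp only [theta, pow_add, pow_mul]; push_cast; ring

theorem phi_even (d : ℕ) (a b c : F) (k : ℕ) :
    phi d a b c (2 * k) = (2 * k : F) * (d - 2 * k + 1) := by
  simp [phi]

theorem phi_odd (d : ℕ) (a b c : F) (k : ℕ) :
    phi d a b c (2 * k + 1) = c ^ 2 - (2 * a + 2 * b - d + 4 * k + 1) ^ 2 / 4 := by
  have : ¬ Even (2 * k + 1) := by simp
  simp only [phi, this, if_false]; push_cast; ring

theorem mat_ext (d : ℕ) {M N : Matrix (Fin (d + 1)) (Fin (d + 1)) F}
    (h : ∀ g : ℕ → F, M.mulVec (res d g) = N.mulVec (res d g)) : M = N := by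
  apply Matrix.toLin'.injective
  ext1 v
  ext1
  obtain ⟨g, hg⟩ := exists_res d (Pi.single v 1 : Fin (d + 1) → F)
  simp only [LinearMap.comp_apply, LinearMap.single_apply, Matrix.toLin'_apply, hg, h]

theorem res_add (d : ℕ) (g h : ℕ → F) : res d g + res d h = res d (g + h) := rfl

theorem res_sub (d : ℕ) (g h : ℕ → F) : res d g - res d h = res d (g - h) := rfl

theorem res_smul (d : ℕ) (r : F) (g : ℕ → F) : r • res d g = res d (r • g) := rfl

theorem scalar_mulVec (d : ℕ) (r : F) (v : Fin (d + 1) → F) :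
    (Matrix.scalar (Fin (d + 1)) r).mulVec v = r • v := by
  funext i
  simp [Matrix.mulVec_diagonal]

theorem seqX_smul (d : ℕ) (a r : F) (g : ℕ → F) : seqX d a (r • g) = r • seqX d a g := by
  funext n
  by_cases h : n = 0
  · simp [seqX, h]; ring
  · simp [seqX, h]; ring

theorem seqY_smul (d : ℕ) (a b c r : F) (g : ℕ → F) :
    seqY d a b c (r • g) = r • seqY d a b c g := by
  funext n
  simp [seqY]; ring

set_option linter.unusedSimpArgs false

theorem seq_lambda [CharZero F] (d : ℕ) (a b c : F) (g : ℕ → F) (n : ℕ) :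
    seqY d a b c (seqX d a (seqY d a b c g)) n + seqY d a b c (seqY d a b c (seqX d a g)) n
      - kappaE d a b c * seqY d a b c g n
      + (seqX d a (seqY d a b c (seqY d a b c g)) n + seqY d a b c (seqX d a (seqY d a b c g)) n
      - kappaE d a b c * seqY d a b c g n) - seqX d a g n = lambdaE d a b c * g n := by
  obtain ⟨k, rfl | rfl⟩ := n.even_or_odd'
  · cases k with
    | zero =>
      have p0 := phi_even d a b c 0
      have t0 := fun x : F => theta_even d x 0
      have p1 := phi_odd d a b c 0
      have t1 := fun x : F => theta_odd d x 0
      have p2 := phi_even d a b c 1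
      have t2 := fun x : F => theta_even d x 1
      norm_num at p0 t0 p1 t1 p2 t2
      simp [seqX, seqY, p0, t0, p1, t1, p2, t2, kappaE, lambdaE]
      field_simp
      ring
    | succ m =>
      have p0 := phi_even d a b c m
      have t0 := fun x : F => theta_even d x m
      have p1 := phi_odd d a b c m
      have t1 := fun x : F => theta_odd d x m
      have p2 := phi_even d a b c (m + 1)
      have t2 := fun x : F => theta_even d x (m + 1)
      have p3 := phi_odd d a b c (m + 1)
      have t3 := fun x : F => theta_odd d x (m + 1)
      have p4 := phi_even d a b c (m + 2)
      have t4 := fun x : F => theta_even d x (m + 2)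
      simp only [mul_add, Nat.reduceMul] at p0 t0 p1 t1 p2 t2 p3 t3 p4 t4 ⊢
      simp [seqX, seqY, p0, t0, p1, t1, p2, t2, p3, t3, p4, t4, kappaE, lambdaE]
      field_simp
      ring
  · cases k with
    | zero =>
      have p0 := phi_even d a b c 0
      have t0 := fun x : F => theta_even d x 0
      have p1 := phi_odd d a b c 0
      have t1 := fun x : F => theta_odd d x 0
      have p2 := phi_even d a b c 1
      have t2 := fun x : F => theta_even d x 1
      have p3 := phi_odd d a b c 1
      have t3 := fun x : F => theta_odd d x 1
      norm_num at p0 t0 p1 t1 p2 t2 p3 t3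
      simp [seqX, seqY, p0, t0, p1, t1, p2, t2, p3, t3, kappaE, lambdaE]
      field_simp
      ring
    | succ m =>
      have p1 := phi_odd d a b c m
      have t1 := fun x : F => theta_odd d x m
      have p2 := phi_even d a b c (m + 1)
      have t2 := fun x : F => theta_even d x (m + 1)
      have p3 := phi_odd d a b c (m + 1)
      have t3 := fun x : F => theta_odd d x (m + 1)
      have p4 := phi_even d a b c (m + 2)
      have t4 := fun x : F => theta_even d x (m + 2)
      have p5 := phi_odd d a b c (m + 2)
      have t5 := fun x : F => theta_odd d x (m + 2)
      simp only [mul_add, Nat.reduceMul] at p1 t1 p2 t2 p3 t3 p4 t4 p5 t5 ⊢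
      simp [seqX, seqY, p1, t1, p2, t2, p3, t3, p4, t4, p5, t5, kappaE, lambdaE]
      field_simp
      ring

theorem seq_mu [CharZero F] (d : ℕ) (a b c : F) (g : ℕ → F) (n : ℕ) :
    seqX d a (seqY d a b c (seqX d a g)) n + seqY d a b c (seqX d a (seqX d a g)) n
      - kappaE d a b c * seqX d a g n
      + (seqX d a (seqX d a (seqY d a b c g)) n + seqX d a (seqY d a b c (seqX d a g)) n
      - kappaE d a b c * seqX d a g n) - seqY d a b c g n = muE d a b c * g n := by
  obtain ⟨k, rfl | rfl⟩ := n.even_or_odd'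
  · cases k with
    | zero =>
      have p0 := phi_even d a b c 0
      have t0 := fun x : F => theta_even d x 0
      have p1 := phi_odd d a b c 0
      have t1 := fun x : F => theta_odd d x 0
      have p2 := phi_even d a b c 1
      have t2 := fun x : F => theta_even d x 1
      norm_num at p0 t0 p1 t1 p2 t2
      simp [seqX, seqY, p0, t0, p1, t1, p2, t2, kappaE, muE]
      field_simp
      ring
    | succ m =>
      have p0 := phi_even d a b c m
      have t0 := fun x : F => theta_even d x m
      have p1 := phi_odd d a b c m
      have t1 := fun x : F => theta_odd d x m
      have p2 := phi_even d a b c (m + 1)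
      have t2 := fun x : F => theta_even d x (m + 1)
      have p3 := phi_odd d a b c (m + 1)
      have t3 := fun x : F => theta_odd d x (m + 1)
      have p4 := phi_even d a b c (m + 2)
      have t4 := fun x : F => theta_even d x (m + 2)
      simp only [mul_add, Nat.reduceMul] at p0 t0 p1 t1 p2 t2 p3 t3 p4 t4 ⊢
      simp [seqX, seqY, p0, t0, p1, t1, p2, t2, p3, t3, p4, t4, kappaE, muE]
      field_simp
      ring
  · cases k with
    | zero =>
      have p0 := phi_even d a b c 0
      have t0 := fun x : F => theta_even d x 0
      have p1 := phi_odd d a b c 0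
      have t1 := fun x : F => theta_odd d x 0
      have p2 := phi_even d a b c 1
      have t2 := fun x : F => theta_even d x 1
      have p3 := phi_odd d a b c 1
      have t3 := fun x : F => theta_odd d x 1
      norm_num at p0 t0 p1 t1 p2 t2 p3 t3
      simp [seqX, seqY, p0, t0, p1, t1, p2, t2, p3, t3, kappaE, muE]
      field_simp
      ring
    | succ m =>
      have p1 := phi_odd d a b c m
      have t1 := fun x : F => theta_odd d x m
      have p2 := phi_even d a b c (m + 1)
      have t2 := fun x : F => theta_even d x (m + 1)
      have p3 := phi_odd d a b c (m + 1)
      have t3 := fun x : F => theta_odd d x (m + 1)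
      have p4 := phi_even d a b c (m + 2)
      have t4 := fun x : F => theta_even d x (m + 2)
      have p5 := phi_odd d a b c (m + 2)
      have t5 := fun x : F => theta_odd d x (m + 2)
      simp only [mul_add, Nat.reduceMul] at p1 t1 p2 t2 p3 t3 p4 t4 p5 t5 ⊢
      simp [seqX, seqY, p1, t1, p2, t2, p3, t3, p4, t4, p5, t5, kappaE, muE]
      field_simp
      ring

theorem matE_lambda [CharZero F] (d : ℕ) (hd : Odd d) (a b c : F) :
    anti (matE d a b c .Y) (matE d a b c .Z) - matE d a b c .X =
      Matrix.scalar _ (lambdaE d a b c) := by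
  apply mat_ext
  intro g
  simp only [matE, anti, Matrix.sub_mulVec, Matrix.add_mulVec, ← Matrix.mulVec_mulVec,
    scalar_mulVec, matX_res, matY_res d hd, res_add, res_sub, res_smul, mul_sub, mul_add,
    add_mul, sub_mul, seqX_smul, seqY_smul]
  congr 1
  funext n
  have h := seq_lambda d a b c g n
  simp only [Pi.add_apply, Pi.sub_apply, Pi.smul_apply, smul_eq_mul]
  linear_combination h

theorem matE_mu [CharZero F] (d : ℕ) (hd : Odd d) (a b c : F) :
    anti (matE d a b c .Z) (matE d a b c .X) - matE d a b c .Y =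
      Matrix.scalar _ (muE d a b c) := by
  apply mat_ext
  intro g
  simp only [matE, anti, Matrix.sub_mulVec, Matrix.add_mulVec, ← Matrix.mulVec_mulVec,
    scalar_mulVec, matX_res, matY_res d hd, res_add, res_sub, res_smul, mul_sub, mul_add,
    add_mul, sub_mul, seqX_smul, seqY_smul]
  congr 1
  funext n
  have h := seq_mu d a b c g n
  simp only [Pi.add_apply, Pi.sub_apply, Pi.smul_apply, smul_eq_mul]
  linear_combination h

theorem matE_kappa (d : ℕ) (a b c : F) :
    anti (matE d a b c .X) (matE d a b c .Y) - matE d a b c .Z =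
      Matrix.scalar _ (kappaE d a b c) := by
  simp [matE]

/-- The representation of the universal Bannai--Ito algebra by the matrices above. -/
noncomputable def repE [CharZero F] (d : ℕ) (hd : Odd d) (a b c : F) :
    BI F →ₐ[F] Matrix (Fin (d + 1)) (Fin (d + 1)) F :=
  lift (matE d a b c)
    (fun g => by
      rw [matE_kappa]; exact Matrix.scalar_commute _ (fun r => Commute.all _ r) _)
    (fun g => by
      rw [matE_lambda d hd]; exact Matrix.scalar_commute _ (fun r => Commute.all _ r) _)
    (fun g => by
      rw [matE_mu d hd]; exact Matrix.scalar_commute _ (fun r => Commute.all _ r) _)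

/-- The `(d+1)`-dimensional module `E_d(a,b,c)`, for odd `d`: the space of column vectors, on which
`X`, `Y`, `Z` act by the matrices `matE`. -/
noncomputable def E [CharZero F] (d : ℕ) (hd : Odd d) (a b c : F) : ModuleCat.{u} (BI F) :=
  letI : Module (BI F) (Fin (d + 1) → F) :=
    Module.compHom (Fin (d + 1) → F)
      ((Matrix.toLinAlgEquiv' : _ ≃ₐ[F] _).toAlgHom.comp (repE d hd a b c)).toRingHom
  ModuleCat.of (BI F) (Fin (d + 1) → F)

end EModule

/-! ### The parameter set and its orbits -/

section Parameters

variable (F : Type u) [Field F]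

/-- The set `{(d-1)/2 - i | i = 0, 2, …, d-1}`. -/
def excluded (d : ℕ) : Set F :=
  {x | ∃ i : ℕ, Even i ∧ i ≤ d - 1 ∧ x = ((d : F) - 1) / 2 - (i : F)}

/-- The set of all admissible parameters `(a, b, c)`. -/
def EP (d : ℕ) : Set (F × F × F) :=
  {p | p.1 + p.2.1 + p.2.2 ∉ excluded F d ∧ -p.1 + p.2.1 + p.2.2 ∉ excluded F d ∧
    p.1 - p.2.1 + p.2.2 ∉ excluded F d ∧ p.1 + p.2.1 - p.2.2 ∉ excluded F d}

theorem neg_mem_excluded [CharZero F] {d : ℕ} (hd : Odd d) {x : F} (hx : -x ∈ excluded F d) :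
    x ∈ excluded F d := by
  obtain ⟨i, hi, hle, e⟩ := hx
  have h1 : 1 ≤ d := hd.pos
  refine ⟨d - 1 - i, ?_, by omega, ?_⟩
  · obtain ⟨k, rfl⟩ := hd
    obtain ⟨m, rfl⟩ := hi
    exact ⟨k - m, by omega⟩
  · rw [Nat.cast_sub hle, Nat.cast_sub h1]
    push_cast
    linear_combination -e

theorem smul_mem_EP [CharZero F] {d : ℕ} (hd : Odd d) (s : ℤˣ × ℤˣ × ℤˣ) {p : F × F × F}
    (hp : p ∈ EP F d) : (s.1 • p.1, s.2.1 • p.2.1, s.2.2 • p.2.2) ∈ EP F d := by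
  obtain ⟨s, t, r⟩ := s
  obtain ⟨a, b, c⟩ := p
  obtain ⟨h1, h2, h3, h4⟩ := hp
  have neg : ∀ x y : F, -x = y → x ∉ excluded F d → y ∉ excluded F d := by
    intro x y e hx hy
    exact hx (neg_mem_excluded F hd (e ▸ hy))
  have cpy : ∀ x y : F, x = y → x ∉ excluded F d → y ∉ excluded F d := by
    intro x y e hx
    exact e ▸ hx
  rcases Int.units_eq_one_or s with rfl | rfl <;>
    rcases Int.units_eq_one_or t with rfl | rfl <;>
    rcases Int.units_eq_one_or r with rfl | rfl <;>
    simp only [one_smul, Units.neg_smul] <;>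
    refine ⟨?_, ?_, ?_, ?_⟩ <;>
    first
    | exact cpy _ _ (by ring1) h1
    | exact cpy _ _ (by ring1) h2
    | exact cpy _ _ (by ring1) h3
    | exact cpy _ _ (by ring1) h4
    | exact neg _ _ (by ring1) h1
    | exact neg _ _ (by ring1) h2
    | exact neg _ _ (by ring1) h3
    | exact neg _ _ (by ring1) h4

/-- The action of `{±1}³` on the parameter set by changing the signs of `a`, `b`, `c`. -/
abbrev actionEP [CharZero F] (d : ℕ) (hd : Odd d) : MulAction (ℤˣ × ℤˣ × ℤˣ) (EP F d) where
  smul s p := ⟨(s.1 • p.1.1, s.2.1 • p.1.2.1, s.2.2 • p.1.2.2), smul_mem_EP F hd s p.2⟩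
  one_smul p := Subtype.ext (by
    change ((1 : ℤˣ) • p.1.1, (1 : ℤˣ) • p.1.2.1, (1 : ℤˣ) • p.1.2.2) = p.1
    simp)
  mul_smul s t p := Subtype.ext (by
    change ((s.1 * t.1) • p.1.1, (s.2.1 * t.2.1) • p.1.2.1, (s.2.2 * t.2.2) • p.1.2.2) =
      (s.1 • t.1 • p.1.1, s.2.1 • t.2.1 • p.1.2.1, s.2.2 • t.2.2 • p.1.2.2)
    simp only [mul_smul])

/-- The set of `{±1}³`-orbits of the parameter set. -/
abbrev EPOrbits [CharZero F] (d : ℕ) (hd : Odd d) : Type u :=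
  letI := actionEP F d hd
  MulAction.orbitRel.Quotient (ℤˣ × ℤˣ × ℤˣ) (EP F d)

/-- The orbit `[a, b, c]` of an admissible parameter. -/
def orbit {F : Type u} [Field F] [CharZero F] {d : ℕ} (hd : Odd d) (p : EP F d) :
    EPOrbits F d hd :=
  letI := actionEP F d hd
  Quotient.mk (MulAction.orbitRel (ℤˣ × ℤˣ × ℤˣ) (EP F d)) p

end Parameters

end BI

/-! On an irreducible module of dimension d+1 the elements κ, λ, μ act as scalars, so Z is
determined by X and Y, and the module is a pair of operators subject to two cubic relations
(`IsPair`). Let Y v = θ v. The first relation at v says that (Y + θ + 1)(Y - (1 - θ)) X v is a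
multiple of v. Hence, if 1 - θ is not an eigenvalue of Y, then Y X v lies in the span of X v and v
with forced coefficients, and v is a highest weight vector. The second relation then shows by
induction that Y acts on the vectors (X - θ_{n-1})⋯(X - θ_0) v with the coefficients θ*_n, φ_n of
E_d(a,b,c) (`apply_chain_right`). By irreducibility d+1 of these vectors form a basis.

Surjectivity. Finiteness of the spectrum yields, after a change of sign, eigenvalues of X and of Y
of the required kind. At first the parameter in the place of d is only some scalar δ. The basis
gives tr Y = -(d+1)/2, exchanging X and Y gives the same trace for X, and the trace of X forces δ =
d (`IsHighest.eq_of_trace`). Exchanging X and Y also shows that ∏(X - θ_i) = 0, so the chain stops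
at length d+1 and V has the structure constants of a twisted E_d(a,b,c). Irreducibility forces
φ_i(a,b,c) and φ_i(-a,b,c) to be non-zero for 1 ≤ i ≤ d, which is the condition defining EP_d
(`mem_EP_iff`).

Irreducibility of E_d(a,b,c) on EP_d. There is a functional r with ∏_{h≥1}(Y - θ*_h) w = r(w) v, so
an invariant subspace on which r does not vanish contains v and is everything. From a non-zero
invariant subspace one extracts some vector ∏_{i≠j}(X - θ_i) v. The values of r at these vectors are
linked by φ_{d-j}(-a,b,c) and φ_{j+1}(a,b,c) (`weight_erase_succ`), so none vanishes. The link comes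
from Z ± Y, which commutes with (X - s₁)(X - s₂) when s₁ + s₂ = ±1, as holds for consecutive θ_i.

Well-definedness and injectivity. The same v serves for -a and for -c. For -b one takes an
eigenvector of Y for θ*_d, possible for b or for -b (`forall_th_ne_or`). Conversely, the traces of X
and Y recover (ε, ε'), and the scalars κ, λ, μ recover a², b², c². -/

namespace BI

/-! ### Structure constants with a free scalar δ in the place of d -/

section Sequences

variable {F : Type*} [Field F]

/-- The sequence `theta` with an arbitrary scalar in the place of the integer `d`. -/
def th (δ a : F) (i : ℕ) : F := (-1) ^ i * (2 * a - δ + 2 * i) / 2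

/-- The sequence `phi` with an arbitrary scalar in the place of the integer `d`. -/
def ph (δ a b c : F) (i : ℕ) : F :=
  if Even i then (i : F) * (δ - i + 1) else c ^ 2 - (2 * a + 2 * b - δ + 2 * i - 1) ^ 2 / 4

/-- The scalar `ν` for which `Y X v = θ*₁ X v + ν v` on the highest weight vector `v`. -/
def nu (δ a b c : F) : F :=
  c ^ 2 - a ^ 2 - (b - (δ - 1) / 2) ^ 2 - δ * (b - (δ - 1) / 2)

theorem th_even (δ a : F) (k : ℕ) : th δ a (2 * k) = (2 * a - δ + 4 * k) / 2 := by
  simp only [th, pow_mul]; push_cast; ring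

theorem th_odd (δ a : F) (k : ℕ) : th δ a (2 * k + 1) = -(2 * a - δ + 4 * k + 2) / 2 := by
  simp only [th, pow_add, pow_mul]; push_cast; ring

theorem ph_even (δ a b c : F) (k : ℕ) : ph δ a b c (2 * k) = (2 * k : F) * (δ - 2 * k + 1) := by
  simp [ph]

theorem ph_odd (δ a b c : F) (k : ℕ) :
    ph δ a b c (2 * k + 1) = c ^ 2 - (2 * a + 2 * b - δ + 4 * k + 1) ^ 2 / 4 := by
  have : ¬ Even (2 * k + 1) := by simp
  simp only [ph, this, if_false]; push_cast; ring

theorem nu_neg_left (δ a b c : F) : nu δ (-a) b c = nu δ a b c := by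
  simp only [nu]; ring

end Sequences

/-! ### Highest weight vectors and the action of Y on their chains -/

section Pairs

variable {F V : Type*} [Field F] [AddCommGroup V] [Module F V]

/-- The relations between the actions of `X` and `Y` on a module of the universal Bannai--Ito
algebra on which `κ`, `λ`, `μ` act as scalars. -/
structure IsPair (X Y : Module.End F V) (κ l m : F) : Prop where
  left : ∀ v, Y (Y (X v)) + (2 : F) • Y (X (Y v)) + X (Y (Y v)) = X v + (2 * κ) • Y v + l • v
  right : ∀ v, X (X (Y v)) + (2 : F) • X (Y (X v)) + Y (X (X v)) = Y v + (2 * κ) • X v + m • v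

theorem IsPair.swap {X Y : Module.End F V} {κ l m : F} (h : IsPair X Y κ l m) :
    IsPair Y X κ m l where
  left := h.right
  right := h.left

/-- The scalar by which `{X,Y} - Z` acts, with an arbitrary scalar in the place of `d`; the two
other central elements act by the same expression in permuted parameters. -/
def cen (δ a b c : F) : F := c ^ 2 - a ^ 2 - b ^ 2 + (δ + 1) ^ 2 / 4

/-- `IsPair` with the scalars `κ`, `λ`, `μ` of `E_δ(a,b,c)`. -/
abbrev IsEPair (X Y : Module.End F V) (δ a b c : F) : Prop :=
  IsPair X Y (cen δ a b c) (cen δ b c a) (cen δ c a b)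

/-- The vectors `(X - t_{n-1}) ⋯ (X - t_0) v`. -/
def chain (X : Module.End F V) (t : ℕ → F) (v : V) : ℕ → V
  | 0 => v
  | n + 1 => X (chain X t v n) - t n • chain X t v n

theorem apply_chain (X : Module.End F V) (t : ℕ → F) (v : V) (n : ℕ) :
    X (chain X t v n) = chain X t v (n + 1) + t n • chain X t v n := by
  simp [chain]

/-- Inductive step for the action of Y: evaluate the `right` relation at q₀ and solve for Y q₂. The
hypotheses `e₂`, `e₁`, `e₀`, `e'` match the coefficients of q₂, q₁, q₀, p. Since `hp` carries the
factor f₀, the start of the chain, which has no predecessor, is covered by f₀ = 0. -/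
theorem chain_step {X Y : Module.End F V} {κ l m : F} (h : IsPair X Y κ l m)
    {p q₀ q₁ q₂ : V} {t' t₀ t₁ s₀ s₁ s₂ f₀ f₁ f₂ : F}
    (hp : f₀ • X p = f₀ • q₀ + (f₀ * t') • p)
    (hX₀ : X q₀ = q₁ + t₀ • q₀) (hX₁ : X q₁ = q₂ + t₁ • q₁)
    (hY₀ : Y q₀ = s₀ • q₀ + f₀ • p) (hY₁ : Y q₁ = s₁ • q₁ + f₁ • q₀)
    (e₂ : s₂ = -s₀ - 2 * s₁)
    (e₁ : (t₁ + t₀) * s₁ + 2 * (s₁ * t₁ + f₁ + t₀ * s₀) + s₀ * (t₁ + t₀) + f₀ + f₂ = 2 * κ)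
    (e₀ : (t₁ + t₀) * f₁ + t₀ ^ 2 * s₀ + 2 * (f₁ + t₀ * s₀) * t₀ + 2 * t₀ * f₀ + s₀ * t₀ ^ 2
      + f₀ * (t₀ + t') = s₀ + 2 * κ * t₀ + m)
    (e' : f₀ * ((t₀ + t') ^ 2 - 1) = 0) :
    Y q₂ = s₂ • q₂ + f₂ • q₁ := by
  have hr := h.right q₀
  have hp' : X (f₀ • p) = f₀ • q₀ + (f₀ * t') • p := by rw [map_smul, hp]
  simp only [hX₀, hX₁, hY₀, hY₁, map_add, map_smul, smul_add, hp'] at hr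
  have hf : f₂ = 2 * κ - ((t₁ + t₀) * s₁ + 2 * (s₁ * t₁ + f₁ + t₀ * s₀) + s₀ * (t₁ + t₀) + f₀) := by
    linear_combination e₁
  have hm : m = (t₁ + t₀) * f₁ + t₀ ^ 2 * s₀ + 2 * (f₁ + t₀ * s₀) * t₀ + 2 * t₀ * f₀ + s₀ * t₀ ^ 2
      + f₀ * (t₀ + t') - s₀ - 2 * κ * t₀ := by
    linear_combination -e₀
  have e3 : (f₀ * ((t₀ + t') ^ 2 - 1)) • p = 0 := by rw [e', zero_smul]
  subst hf hm e₂
  linear_combination (norm := module) hr - e3 - t' • hp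

variable [CharZero F]

/-- Two-step induction through `chain_step`. The coefficient of the oldest vector vanishes because
consecutive θ_i add up to ±1. No relation between δ and the dimension of V is needed. -/
theorem apply_chain_right {X Y : Module.End F V} {δ a b c : F} (h : IsEPair X Y δ a b c) {v : V}
    (h₀ : Y v = th δ b 0 • v) (h₁ : Y (X v) = th δ b 1 • X v + nu δ a b c • v) (n : ℕ) :
    Y (chain X (th δ a) v (n + 1)) =
      th δ b (n + 1) • chain X (th δ a) v (n + 1) + ph δ a b c (n + 1) • chain X (th δ a) v n := by
  have base : Y (chain X (th δ a) v 1) =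
      th δ b 1 • chain X (th δ a) v 1 + ph δ a b c 1 • chain X (th δ a) v 0 := by
    have e : ph δ a b c 1 = nu δ a b c - th δ a 0 * (th δ b 0 - th δ b 1) := by
      simp [ph, nu, th]; field_simp; ring
    simp only [chain, map_sub, map_smul, h₀, h₁, e]
    module
  induction n using Nat.strong_induction_on with
  | _ n ih =>
  match n with
  | 0 => exact base
  | 1 =>
    -- The vector v has no predecessor, hence p = 0 and f₀ = 0.
    refine chain_step h (p := 0) (f₀ := 0) (t' := 0) (by simp) (apply_chain X _ v 0)
      (apply_chain X _ v 1) (s₀ := th δ b 0) (by simp [chain, h₀]) base ?_ ?_ ?_ (by simp)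
    · simp [th]; field_simp; ring
    · simp [th, ph, cen, show ¬ Even (0 + 1) by simp, show Even (1 + 1) by decide]
      field_simp; ring
    · simp [th, ph, cen]; field_simp; ring
  | k + 2 =>
    refine chain_step h (p := chain X (th δ a) v k) (f₀ := ph δ a b c (k + 1)) (t' := th δ a k)
      (by rw [apply_chain]; module) (apply_chain X _ v (k + 1))
      (apply_chain X _ v (k + 2)) (s₀ := th δ b (k + 1)) (ih k (by omega)) (ih (k + 1) (by omega))
      ?_ ?_ ?_ ?_
    all_goals obtain ⟨j, rfl | rfl⟩ := k.even_or_odd'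
    · simp [th, pow_succ, pow_mul]; field_simp; ring
    · simp [th, pow_succ, pow_mul]; field_simp; ring
    · have p2 := ph_even δ a b c (j + 1)
      have p1 := ph_odd δ a b c j
      have p3 := ph_odd δ a b c (j + 1)
      simp only [mul_add, mul_one] at p2 p3
      simp only [add_assoc, Nat.reduceAdd] at p1 p2 p3 ⊢
      rw [p1, p2, p3]
      simp [th, cen, pow_succ, pow_mul]; field_simp; ring
    · have p2 := ph_even δ a b c (j + 1)
      have p3 := ph_odd δ a b c (j + 1)
      have p4 := ph_even δ a b c (j + 2)
      simp only [mul_add, Nat.reduceMul, mul_one] at p2 p3 p4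
      simp only [add_assoc, Nat.reduceAdd] at p2 p3 p4 ⊢
      rw [p2, p3, p4]
      simp [th, cen, pow_succ, pow_mul]; field_simp; ring
    · have p2 := ph_even δ a b c (j + 1)
      have p1 := ph_odd δ a b c j
      simp only [mul_add, mul_one] at p2
      simp only [add_assoc, Nat.reduceAdd] at p1 p2 ⊢
      rw [p1, p2]
      simp [th, cen, pow_succ, pow_mul]; field_simp; ring
    · have p2 := ph_even δ a b c (j + 1)
      have p3 := ph_odd δ a b c (j + 1)
      simp only [mul_add, mul_one] at p2 p3
      simp only [add_assoc, Nat.reduceAdd] at p2 p3 ⊢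
      rw [p2, p3]
      simp [th, cen, pow_succ, pow_mul]; field_simp; ring
    · apply mul_eq_zero_of_right
      simp [th, pow_succ, pow_mul]; field_simp; ring
    · apply mul_eq_zero_of_right
      simp [th, pow_succ, pow_mul]; field_simp; ring

/-- With θ = θ*_0 the `left` relation at v reads (Y - (1 - θ))(Y + θ + 1) X v = (λ + 2κθ) v, and the
right side is (2θ - 1)ν v. So Y X v - θ*_1 X v - ν v is killed by Y - (1 - θ), and it is zero unless
1 - θ is an eigenvalue. -/
theorem apply_apply_of_not_hasEigenvalue {X Y : Module.End F V} {δ a b c : F}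
    (h : IsEPair X Y δ a b c) {v : V} (h₀ : Y v = th δ b 0 • v)
    (hne : ¬ Y.HasEigenvalue (1 - th δ b 0)) (hv : v ≠ 0) :
    Y (X v) = th δ b 1 • X v + nu δ a b c • v := by
  have hθ : 2 * th δ b 0 - 1 ≠ 0 := by
    intro e
    apply hne
    have : 1 - th δ b 0 = th δ b 0 := by linear_combination -e
    rw [this]
    exact Module.End.hasEigenvalue_of_hasEigenvector
      (Module.End.hasEigenvector_iff.2 ⟨Module.End.mem_eigenspace_iff.2 h₀, hv⟩)
  by_contra hw
  apply hne
  refine Module.End.hasEigenvalue_of_hasEigenvector (x := Y (X v) - th δ b 1 • X v - nu δ a b c • v)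
    (Module.End.hasEigenvector_iff.2 ⟨Module.End.mem_eigenspace_iff.2 ?_, ?_⟩)
  · have hl := h.left v
    have e1 : th δ b 1 = - th δ b 0 - 1 := by simp [th]; field_simp; ring
    have e2 : cen δ b c a + 2 * cen δ a b c * th δ b 0 = (2 * th δ b 0 - 1) * nu δ a b c := by
      simp [th, cen, nu]; field_simp; ring
    have e2' : (cen δ b c a + 2 * cen δ a b c * th δ b 0) • v =
      ((2 * th δ b 0 - 1) * nu δ a b c) • v := by rw [e2]
    simp only [h₀, map_smul, map_sub, e1] at hl ⊢
    linear_combination (norm := module) hl + e2'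
  · intro e
    apply hw
    rw [sub_sub, sub_eq_zero] at e
    exact e

end Pairs

open Polynomial in
/-- The product of the linear polynomials with roots `t j`, `j ∈ s`. -/
noncomputable def lprod {F : Type*} [Field F] (t : ℕ → F) (s : Finset ℕ) : F[X] :=
  ∏ j ∈ s, (X - C (t j))

/-! ### Polynomials in X and the operators Z ± Y -/

section Weight

variable {F V : Type*} [Field F] [AddCommGroup V] [Module F V]

theorem aeval_linear (X : Module.End F V) (s : F) (w : V) :
    Polynomial.aeval X (Polynomial.X - Polynomial.C s) w = X w - s • w := by
  simp [Module.algebraMap_end_apply]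

theorem aeval_linear_mul (X : Module.End F V) (s : F) (p : Polynomial F) (w : V) :
    Polynomial.aeval X ((Polynomial.X - Polynomial.C s) * p) w =
      X (Polynomial.aeval X p w) - s • Polynomial.aeval X p w := by
  rw [map_mul, Module.End.mul_apply, aeval_linear]

theorem aeval_quadratic (X : Module.End F V) (s₁ s₂ : F) (w : V) :
    Polynomial.aeval X ((Polynomial.X - Polynomial.C s₁) * (Polynomial.X - Polynomial.C s₂)) w =
      X (X w) - (s₁ + s₂) • X w + (s₁ * s₂) • w := by
  rw [map_mul, Module.End.mul_apply, aeval_linear, aeval_linear, map_sub, map_smul]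
  module

theorem chain_eq_aeval (X : Module.End F V) (t : ℕ → F) (v : V) (n : ℕ) :
    chain X t v n = Polynomial.aeval X (lprod t (Finset.range n)) v := by
  induction n with
  | zero => simp [chain, lprod]
  | succ n ih =>
    rw [lprod, Finset.prod_range_succ, mul_comm, map_mul, Module.End.mul_apply, aeval_linear,
      ← lprod, ← ih, chain]

/-- For t = θ the two roots in each pair add up to -1, which suits Z - Y. -/
theorem lprod_range_eq_pairs (t : ℕ → F) (m : ℕ) :
    lprod t (Finset.range (2 * m)) = ∏ j ∈ Finset.range m,
      ((Polynomial.X - Polynomial.C (t (2 * j))) *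
        (Polynomial.X - Polynomial.C (t (2 * j + 1)))) := by
  induction m with
  | zero => simp [lprod]
  | succ m ih =>
    rw [Finset.prod_range_succ, ← ih, lprod, lprod, mul_add, mul_one, Finset.prod_range_succ,
      Finset.prod_range_succ, mul_assoc]

/-- For t = θ the shifted pairs add up to 1, which suits Z + Y. The two end roots remain as a
separate quadratic factor. -/
theorem lprod_range_eq_shifted_pairs (t : ℕ → F) (n : ℕ) :
    lprod t (Finset.range (2 * n + 2)) =
      ((Polynomial.X - Polynomial.C (t 0)) * (Polynomial.X - Polynomial.C (t (2 * n + 1)))) *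
      ∏ j ∈ Finset.range n, ((Polynomial.X - Polynomial.C (t (2 * j + 1))) *
        (Polynomial.X - Polynomial.C (t (2 * j + 2)))) := by
  have : lprod t (Finset.range (2 * n + 1)) = (Polynomial.X - Polynomial.C (t 0)) *
      ∏ j ∈ Finset.range n, ((Polynomial.X - Polynomial.C (t (2 * j + 1))) *
        (Polynomial.X - Polynomial.C (t (2 * j + 2)))) := by
    induction n with
    | zero => simp [lprod]
    | succ m ih =>
      rw [Finset.prod_range_succ, ← mul_assoc, ← ih, lprod, lprod, mul_add, mul_one,
        Finset.prod_range_succ, Finset.prod_range_succ, mul_assoc]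
  rw [lprod, Finset.prod_range_succ, ← lprod, this]
  ring

theorem lprod_erase_mul (t : ℕ → F) {s : Finset ℕ} {k : ℕ} (hk : k ∈ s) :
    lprod t (s.erase k) * (Polynomial.X - Polynomial.C (t k)) = lprod t s :=
  Finset.prod_erase_mul _ _ hk

/-- The action of `Z + s Y` in terms of the actions of `X` and `Y`. -/
def dunkl (X Y : Module.End F V) (κ s : F) : Module.End F V :=
  X * Y + Y * X - κ • 1 + s • Y

theorem dunkl_apply (X Y : Module.End F V) (κ s : F) (w : V) :
    dunkl X Y κ s w = X (Y w) + Y (X w) - κ • w + s • Y w := rfl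

/-- For D = Z + sY with s² = 1 one has XD + DX = sD plus a scalar, so X² - sX commutes with D. -/
theorem IsPair.commute_dunkl {X Y : Module.End F V} {κ l m : F} (h : IsPair X Y κ l m) {s : F}
    (hs : s ^ 2 = 1) {s₁ s₂ : F} (e : s₁ + s₂ = s) :
    Commute (Polynomial.aeval X ((Polynomial.X - Polynomial.C s₁) *
      (Polynomial.X - Polynomial.C s₂))) (dunkl X Y κ s) := by
  refine LinearMap.ext fun w => ?_
  have r₁ := congrArg X (h.right w)
  have r₂ := h.right (X w)
  have e₁ : (1 - s ^ 2) • X (Y w) = 0 := by simp [hs]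
  have e₂ : (1 - s ^ 2) • Y (X w) = 0 := by simp [hs]
  obtain rfl : s₂ = s - s₁ := by linear_combination e
  simp only [Module.End.mul_apply, aeval_quadratic, dunkl_apply]
  simp only [map_add, map_sub, map_smul] at r₁ r₂ ⊢
  linear_combination (norm := module) r₁ - r₂ + e₁ - e₂

theorem commute_aeval_prod (X D : Module.End F V) {s : Finset ℕ} {f : ℕ → Polynomial F}
    (h : ∀ j ∈ s, Commute (Polynomial.aeval X (f j)) D) :
    Commute (Polynomial.aeval X (∏ j ∈ s, f j)) D := by
  refine Finset.prod_induction f (fun p => Commute (Polynomial.aeval X p) D) ?_ ?_ h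
  · intro p q hp hq
    rw [map_mul]
    exact hp.mul_left hq
  · rw [map_one]
    exact Commute.one_left D

/-- Put D = Z + sY and y = p(X) v. On v the operator D acts as -X plus a scalar, and so it does on
y, because D commutes with p(X). Dually, r ∘ D is -r ∘ X plus the same multiple of r. Computing r(D
X y) in both ways gives a linear relation between r(X² y), r(X y) and r(y). -/
theorem IsPair.weight_dunkl {X Y : Module.End F V} {κ l m : F} (h : IsPair X Y κ l m) {s : F}
    (hs : s ^ 2 = 1) {v : V} {t₀ ν : F} (h₀ : Y v = t₀ • v)
    (h₁ : Y (X v) = (-t₀ - 1) • X v + ν • v)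
    {r : V →ₗ[F] F} (hr₀ : ∀ w, r (Y w) = t₀ * r w)
    (hr₁ : ∀ w, r (X (Y w)) = (-t₀ - 1) * r (X w) + ν * r w)
    {p : Polynomial F} (hp : Commute (Polynomial.aeval X p) (dunkl X Y κ s)) :
    2 * r (X (X (Polynomial.aeval X p v))) =
      (2 * (ν - κ + s * t₀) + s) * r (X (Polynomial.aeval X p v)) -
        (m + s * κ + s * (ν - κ + s * t₀)) * r (Polynomial.aeval X p v) := by
  have hDv : dunkl X Y κ s v = -X v + (ν - κ + s * t₀) • v := by
    rw [dunkl_apply, h₁, h₀, map_smul]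
    module
  have hXp : ∀ w, Polynomial.aeval X p (X w) = X (Polynomial.aeval X p w) := fun w => by
    have := map_mul (Polynomial.aeval X) p Polynomial.X
    rw [mul_comm, map_mul, Polynomial.aeval_X] at this
    exact (LinearMap.congr_fun this w).symm
  set y := Polynomial.aeval X p v with hy
  have hDy : dunkl X Y κ s y = -X y + (ν - κ + s * t₀) • y := by
    have := LinearMap.congr_fun hp.eq v
    rw [Module.End.mul_apply, Module.End.mul_apply, hDv, map_add, map_neg, map_smul, hXp] at this
    exact this.symm
  have hr := h.right y
  have e₁ : (1 - s ^ 2) • Y y = 0 := by simp [hs]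
  have hDX : dunkl X Y κ s (X y) =
      -X (dunkl X Y κ s y) + s • dunkl X Y κ s y + (m + s * κ) • y := by
    simp only [dunkl_apply, map_add, map_sub, map_smul]
    linear_combination (norm := module) hr + e₁
  have hrD : r (dunkl X Y κ s (X y)) = - r (X (X y)) + (ν - κ + s * t₀) * r (X y) := by
    simp only [dunkl_apply, map_add, map_sub, map_smul, hr₀, hr₁, smul_eq_mul]
    ring
  rw [hDX, hDy] at hrD
  simp only [map_add, map_smul, map_neg, smul_eq_mul] at hrD
  linear_combination hrD

end Weight

/-! ### The weight functional r -/

section Irreducible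

variable {F V : Type*} [Field F] [AddCommGroup V] [Module F V]

theorem chain_mem {X : Module.End F V} {t : ℕ → F} {v : V} {W : Submodule F V}
    (hX : ∀ w ∈ W, X w ∈ W) (hv : v ∈ W) (n : ℕ) : chain X t v n ∈ W := by
  induction n with
  | zero => exact hv
  | succ n ih => exact W.sub_mem (hX _ ih) (W.smul_mem _ ih)

theorem aeval_mem {X : Module.End F V} {W : Submodule F V} (hX : ∀ w ∈ W, X w ∈ W)
    (p : Polynomial F) {w : V} (hw : w ∈ W) : Polynomial.aeval X p w ∈ W := by
  induction p using Polynomial.induction_on' with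
  | add p q hp hq => rw [map_add]; exact W.add_mem hp hq
  | monomial n a =>
    rw [Polynomial.aeval_monomial, Module.End.mul_apply, Module.algebraMap_end_apply]
    refine W.smul_mem _ ?_
    induction n with
    | zero => simpa
    | succ n ih => rw [pow_succ', Module.End.mul_apply]; exact hX _ ih

/-- Each factor Y - s_n cancels the diagonal term on w_n and lowers the index by one, contributing
f_n. -/
theorem aeval_lprod_chain {Y : Module.End F V} {s f : ℕ → F} {w : ℕ → V}
    (h : ∀ n, Y (w (n + 1)) = s (n + 1) • w (n + 1) + f (n + 1) • w n) (n : ℕ) :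
    Polynomial.aeval Y (lprod s (Finset.Ico 1 (n + 1))) (w n) =
      (∏ i ∈ Finset.range n, f (i + 1)) • w 0 := by
  induction n with
  | zero => simp [lprod]
  | succ n ih =>
    rw [lprod, Finset.prod_Ico_succ_top (by omega), map_mul, Module.End.mul_apply, aeval_linear,
      h n, add_sub_cancel_left, map_smul, ← lprod, ih, smul_smul, Finset.prod_range_succ, mul_comm]

theorem aeval_lprod_range_chain {Y : Module.End F V} {s f : ℕ → F} {w : ℕ → V}
    (h₀ : Y (w 0) = s 0 • w 0)
    (h : ∀ n, Y (w (n + 1)) = s (n + 1) • w (n + 1) + f (n + 1) • w n) (n : ℕ) :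
    Polynomial.aeval Y (lprod s (Finset.range (n + 1))) (w n) = 0 := by
  induction n with
  | zero => simp [lprod, h₀, Module.algebraMap_end_apply]
  | succ n ih =>
    rw [lprod, Finset.prod_range_succ, map_mul, Module.End.mul_apply, aeval_linear,
      h n, add_sub_cancel_left, map_smul, ← lprod, ih, smul_zero]

/-- The value of the weight functional on the `n`-th vector of the basis. -/
def weight (d : ℕ) (a b c : F) (n : ℕ) : F :=
  (∏ i ∈ Finset.range n, ph (d : F) a b c (i + 1)) *
    ∏ h ∈ Finset.Ico (n + 1) (d + 1), (th (d : F) b 0 - th (d : F) b h)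

theorem ph_last {d : ℕ} (hd : Odd d) (a b c : F) : ph (d : F) a b c (d + 1) = 0 :=
  phi_last d hd a b c

theorem weight_succ {d : ℕ} (hd : Odd d) (a b c : F) {n : ℕ} (hn : n ≤ d) :
    weight d a b c (n + 1) * (th (d : F) b 0 - th (d : F) b (n + 1)) =
      ph (d : F) a b c (n + 1) * weight d a b c n := by
  rcases hn.lt_or_eq with hn | rfl
  · rw [weight, weight, Finset.prod_range_succ, Finset.prod_eq_prod_Ico_succ_bot
      (show n + 1 < d + 1 by omega)]
    ring
  · rw [weight, Finset.prod_range_succ, ph_last hd]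
    simp

variable [CharZero F]

/-- Identity r(X Y w) = θ*_1 r(X w) + ν r(w) on the n-th chain vector, after simplification by
`weight_succ`. At n = 0 the index n - 1 truncates, harmlessly because the factor θ*_0 - θ*_n is then
zero. -/
theorem weight_succ' {d : ℕ} (hd : Odd d) (a b c : F) {n : ℕ} (hn : n ≤ d) :
    (th (d : F) b n - th (d : F) b 1) * weight d a b c (n + 1) + ph (d : F) a b c n *
      weight d a b c n + (th (d : F) b n - th (d : F) b 1) * th (d : F) a n * weight d a b c n
      + th (d : F) a (n - 1) * (th (d : F) b 0 - th (d : F) b n) * weight d a b c n =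
    nu (d : F) a b c * weight d a b c n := by
  have h := weight_succ hd a b c hn
  obtain ⟨k, rfl | rfl⟩ := n.even_or_odd'
  · have e : th (d : F) b (2 * k) - th (d : F) b 1 = th (d : F) b 0 - th (d : F) b (2 * k + 1) := by
      simp [th, pow_succ, pow_mul]; field_simp; ring
    have e' : (th (d : F) b (2 * k) - th (d : F) b 1) * th (d : F) a (2 * k)
        + th (d : F) a (2 * k - 1) * (th (d : F) b 0 - th (d : F) b (2 * k)) =
        nu (d : F) a b c - ph (d : F) a b c (2 * k) - ph (d : F) a b c (2 * k + 1) := by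
      rw [ph_even, ph_odd]
      cases k with
      | zero => simp [th, nu]; field_simp; ring
      | succ k =>
        rw [show 2 * (k + 1) - 1 = 2 * k + 1 by omega]
        simp [th, pow_succ, pow_mul, nu]; field_simp; ring
    rw [← e] at h
    linear_combination h + weight d a b c (2 * k) * e'
  -- For odd n = 2k+1, θ*_n - θ*_1 = -2k and θ*_0 - θ*_{n+1} = -(2k+2) are proportional. Scaling by
  -- 2k+2 lets `weight_succ` eliminate the next weight.
  · have hk : (2 * k + 2 : F) ≠ 0 := by exact_mod_cast (by omega : 2 * k + 2 ≠ 0)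
    have e : (2 * k + 2 : F) * (th (d : F) b (2 * k + 1) - th (d : F) b 1) =
        2 * k * (th (d : F) b 0 - th (d : F) b (2 * k + 1 + 1)) := by
      simp [th, pow_succ, pow_mul]; field_simp; ring
    have e' : (2 * k + 2 : F) * ((th (d : F) b (2 * k + 1) - th (d : F) b 1) *
        th (d : F) a (2 * k + 1)
        + th (d : F) a (2 * k) * (th (d : F) b 0 - th (d : F) b (2 * k + 1))) =
        (2 * k + 2 : F) * (nu (d : F) a b c - ph (d : F) a b c (2 * k + 1))
          - 2 * k * ph (d : F) a b c (2 * k + 1 + 1) := by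
      have := ph_even (d : F) a b c (k + 1)
      rw [mul_add, mul_one] at this
      rw [ph_odd, this]
      simp [th, pow_succ, pow_mul, nu]; field_simp; ring
    apply mul_left_cancel₀ hk
    rw [show 2 * k + 1 - 1 = 2 * k by omega]
    linear_combination (2 * k) * h + weight d a b c (2 * k + 1) * e' +
      weight d a b c (2 * k + 1 + 1) * e

/-- The data of a highest weight vector `v` with the parameters `(a, b, c)`. -/
structure IsHighest (X Y : Module.End F V) (δ a b c : F) (v : V) : Prop where
  pair : IsEPair X Y δ a b c
  weight : Y v = th δ b 0 • v
  next : Y (X v) = th δ b 1 • X v + nu δ a b c • v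

theorem IsHighest.apply_chain_right {X Y : Module.End F V} {δ a b c : F} {v : V}
    (h : IsHighest X Y δ a b c v) (n : ℕ) :
    Y (chain X (th δ a) v (n + 1)) =
      th δ b (n + 1) • chain X (th δ a) v (n + 1) + ph δ a b c (n + 1) • chain X (th δ a) v n :=
  BI.apply_chain_right h.pair h.weight h.next n

/-- The operator ∏_{h≥1}(Y - θ*_h) has image in the line of v, and r is its coefficient. The first
two properties make r a highest weight vector for the dual action. -/
theorem exists_weight {d : ℕ} (hd : Odd d) {X Y : Module.End F V} {a b c : F} {v : V}
    (h : IsHighest X Y (d : F) a b c v) (B : Module.Basis (Fin (d + 1)) F V)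
    (hB : ∀ i : Fin (d + 1), B i = chain X (th (d : F) a) v i)
    (hend : chain X (th (d : F) a) v (d + 1) = 0) :
    ∃ r : V →ₗ[F] F, (∀ w, r (Y w) = th (d : F) b 0 * r w) ∧
      (∀ w, r (X (Y w)) = th (d : F) b 1 * r (X w) + nu (d : F) a b c * r w) ∧
      (∀ w, Polynomial.aeval Y (lprod (th (d : F) b) (Finset.Ico 1 (d + 1))) w = r w • v) ∧
      r (chain X (th (d : F) a) v d) = ∏ i ∈ Finset.range d, ph (d : F) a b c (i + 1) := by
  set r : V →ₗ[F] F := B.constr F fun i => weight d a b c i with hr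
  have hr' : ∀ n ≤ d, r (chain X (th (d : F) a) v n) = weight d a b c n := by
    intro n hn
    have : r (B ⟨n, by omega⟩) = weight d a b c n := B.constr_basis F _ _
    rwa [hB] at this
  have hr'' : ∀ n ≤ d, r (chain X (th (d : F) a) v (n + 1)) = weight d a b c (n + 1) := by
    intro n hn
    rcases hn.lt_or_eq with hn | rfl
    · exact hr' _ hn
    · rw [hend, map_zero, weight, Finset.prod_range_succ, ph_last hd]
      simp
  refine ⟨r, fun w => ?_, fun w => ?_, fun w => ?_, ?_⟩
  · suffices e : r ∘ₗ Y = th (d : F) b 0 • r from LinearMap.congr_fun e w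
    refine B.ext fun i => ?_
    rw [LinearMap.comp_apply, LinearMap.smul_apply, hB]
    obtain ⟨n, hn⟩ := i
    cases n with
    | zero =>
      simp only [chain, h.weight, map_smul]
    | succ n =>
      simp only
      rw [h.apply_chain_right, map_add, map_smul, map_smul, hr' _ (by omega), hr' _ (by omega)]
      have := weight_succ hd a b c (show n ≤ d by omega)
      simp only [smul_eq_mul]
      linear_combination -this
  · suffices e : r ∘ₗ X ∘ₗ Y = th (d : F) b 1 • r ∘ₗ X + nu (d : F) a b c • r from
      LinearMap.congr_fun e w
    refine B.ext fun i => ?_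
    obtain ⟨n, hn⟩ := i
    simp only [LinearMap.comp_apply, LinearMap.smul_apply, LinearMap.add_apply, hB]
    have e := weight_succ' hd a b c (show n ≤ d by omega)
    cases n with
    | zero =>
      have hw : Y (chain X (th (d : F) a) v 0) = th (d : F) b 0 • chain X (th (d : F) a) v 0 :=
        h.weight
      rw [hw, map_smul, apply_chain, map_smul, map_add, map_smul, hr'' 0 (by omega),
        hr' 0 (by omega)]
      simp only [smul_eq_mul]
      have : ph (d : F) a b c 0 = 0 := by simp [ph]
      rw [this] at e
      linear_combination e
    | succ n =>
      have e2 := weight_succ hd a b c (show n ≤ d by omega)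
      rw [h.apply_chain_right]
      simp only [map_add, map_smul, apply_chain]
      rw [hr'' _ (by omega), hr' _ (by omega), hr' _ (by omega)]
      simp only [smul_eq_mul]
      rw [Nat.add_sub_cancel] at e
      linear_combination e - th (d : F) a n * e2
  · suffices e : Polynomial.aeval Y (lprod (th (d : F) b) (Finset.Ico 1 (d + 1))) =
        r.smulRight v from LinearMap.congr_fun e w
    refine B.ext fun i => ?_
    obtain ⟨n, hn⟩ := i
    -- Split the product after the factor n: the factors 1, …, n carry the n-th chain vector down to
    -- a multiple of v, and the rest acts on v by a scalar.
    rw [hB, LinearMap.smulRight_apply, hr' _ (by simpa using Nat.le_of_lt_succ hn), lprod,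
      ← Finset.prod_Ico_consecutive _ (show 1 ≤ n + 1 by omega) (show n + 1 ≤ d + 1 by omega),
      mul_comm, map_mul, Module.End.mul_apply, ← lprod, ← lprod]
    simp only
    rw [aeval_lprod_chain (w := chain X (th (d : F) a) v) h.apply_chain_right, map_smul,
      weight, mul_smul]
    congr 1
    have key : ∀ p : Polynomial F, Polynomial.aeval Y p v = p.eval (th (d : F) b 0) • v := by
      intro p
      by_cases hv : v = 0
      · simp [hv]
      · exact Module.End.aeval_apply_of_hasEigenvector
          (Module.End.hasEigenvector_iff.2 ⟨Module.End.mem_eigenspace_iff.2 h.weight, hv⟩)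
    rw [chain, key, lprod, Polynomial.eval_prod]
    simp
  · rw [hr' d le_rfl, weight]
    simp

end Irreducible

/-! ### Sufficiency of the parameter conditions for irreducibility -/

section Irreducible

variable {F V : Type*} [Field F] [AddCommGroup V] [Module F V]

theorem lprod_erase_pair {t : ℕ → F} {s : Finset ℕ} {f : ℕ → Polynomial F} {k i : ℕ}
    {g : Polynomial F} {T : Finset ℕ} (hi : i ∈ T) (hs : lprod t s = g * ∏ j ∈ T, f j)
    (hf : f i = (Polynomial.X - Polynomial.C (t k)) * (Polynomial.X - Polynomial.C (t (k + 1))))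
    (hk : k ∈ s) (hk' : k + 1 ∈ s) :
    lprod t (s.erase k) =
        (Polynomial.X - Polynomial.C (t (k + 1))) * (g * ∏ j ∈ T.erase i, f j) ∧
      lprod t (s.erase (k + 1)) =
        (Polynomial.X - Polynomial.C (t k)) * (g * ∏ j ∈ T.erase i, f j) := by
  have e := Finset.prod_erase_mul T f hi
  constructor
  · apply mul_right_cancel₀ (Polynomial.X_sub_C_ne_zero (t k))
    rw [lprod_erase_mul t hk, hs, ← e, hf]
    ring
  · apply mul_right_cancel₀ (Polynomial.X_sub_C_ne_zero (t (k + 1)))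
    rw [lprod_erase_mul t hk', hs, ← e, hf]
    ring

variable [CharZero F]

/-- The products omitting k and k+1 differ only in one linear factor of the pair (θ_k, θ_{k+1}). The
remaining pairs commute with Z - Y for even k and with Z + Y for odd k, so `weight_dunkl` compares
the two values of r. -/
theorem weight_erase_succ {d : ℕ} (hd : Odd d) {X Y : Module.End F V} {a b c : F} {v : V}
    (h : IsHighest X Y (d : F) a b c v) (hend : chain X (th (d : F) a) v (d + 1) = 0)
    {r : V →ₗ[F] F} (hr₀ : ∀ w, r (Y w) = th (d : F) b 0 * r w)
    (hr₁ : ∀ w, r (X (Y w)) = th (d : F) b 1 * r (X w) + nu (d : F) a b c * r w)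
    {k : ℕ} (hk : k < d) :
    r (Polynomial.aeval X (lprod (th (d : F) a) ((Finset.range (d + 1)).erase (k + 1))) v) *
        ph (d : F) (-a) b c (d - k) =
      r (Polynomial.aeval X (lprod (th (d : F) a) ((Finset.range (d + 1)).erase k)) v) *
        ph (d : F) a b c (k + 1) := by
  have t1 : th (d : F) b 1 = - th (d : F) b 0 - 1 := by simp [th]; field_simp; ring
  have h₁ := h.next
  rw [t1] at h₁ hr₁
  obtain ⟨n, rfl⟩ := hd
  rw [chain_eq_aeval] at hend
  obtain ⟨i, rfl | rfl⟩ := k.even_or_odd'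
  · have hs := lprod_range_eq_pairs (th ((2 * n + 1 : ℕ) : F) a) (n + 1)
    rw [← one_mul (∏ j ∈ _, _), show 2 * (n + 1) = 2 * n + 1 + 1 by ring] at hs
    obtain ⟨e₀, e₁⟩ := lprod_erase_pair (k := 2 * i) (i := i) (by simp; omega) hs rfl
      (by simp; omega) (by simp; omega)
    rw [e₀, e₁]
    set p := 1 * ∏ j ∈ (Finset.range (n + 1)).erase i,
      ((Polynomial.X - Polynomial.C (th ((2 * n + 1 : ℕ) : F) a (2 * j))) *
        (Polynomial.X - Polynomial.C (th ((2 * n + 1 : ℕ) : F) a (2 * j + 1)))) with hp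
    have hc : Commute (Polynomial.aeval X p) (dunkl X Y (cen ((2 * n + 1 : ℕ) : F) a b c) (-1)) := by
      rw [hp, one_mul]
      refine commute_aeval_prod X _ fun j _ => h.pair.commute_dunkl (by norm_num) ?_
      rw [th_even, th_odd]; field_simp; ring
    have key := h.pair.weight_dunkl (by norm_num) h.weight h₁ hr₀ hr₁ hc
    have hz : X (X (Polynomial.aeval X p v)) =
        (th ((2 * n + 1 : ℕ) : F) a (2 * i) + th ((2 * n + 1 : ℕ) : F) a (2 * i + 1)) •
          X (Polynomial.aeval X p v) - (th ((2 * n + 1 : ℕ) : F) a (2 * i) *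
            th ((2 * n + 1 : ℕ) : F) a (2 * i + 1)) • Polynomial.aeval X p v := by
      have e2 : lprod (th ((2 * n + 1 : ℕ) : F) a) (Finset.range (2 * n + 1 + 1)) =
          ((Polynomial.X - Polynomial.C (th ((2 * n + 1 : ℕ) : F) a (2 * i))) *
            (Polynomial.X - Polynomial.C (th ((2 * n + 1 : ℕ) : F) a (2 * i + 1)))) * p := by
        rw [← lprod_erase_mul _ (show 2 * i ∈ Finset.range (2 * n + 1 + 1) by simp; omega), e₀]
        ring
      rw [e2, map_mul, Module.End.mul_apply, aeval_quadratic] at hend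
      linear_combination (norm := module) hend
    rw [hz] at key
    simp only [aeval_linear_mul, map_sub, map_smul, smul_eq_mul] at key ⊢
    have e3 : 2 * n + 1 - 2 * i = 2 * (n - i) + 1 := by omega
    have e4 : ((n - i : ℕ) : F) = n - i := Nat.cast_sub (by omega)
    rw [ph_odd, e3, ph_odd, e4]
    rw [th_even, th_odd] at key ⊢
    simp only [th, nu, cen] at key
    push_cast at key ⊢
    -- The multiplier of `key` is θ_{2i} - θ_{2i+1}; it is not assumed non-zero.
    linear_combination (2 * a - (2 * n + 1) + 4 * i + 1) * key / 2
  · have hs := lprod_range_eq_shifted_pairs (th ((2 * n + 1 : ℕ) : F) a) n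
    obtain ⟨e₀, e₁⟩ := lprod_erase_pair (k := 2 * i + 1) (i := i) (by simp; omega) hs rfl
      (by simp; omega) (by simp; omega)
    rw [e₀, e₁]
    set p := ∏ j ∈ (Finset.range n).erase i,
      ((Polynomial.X - Polynomial.C (th ((2 * n + 1 : ℕ) : F) a (2 * j + 1))) *
        (Polynomial.X - Polynomial.C (th ((2 * n + 1 : ℕ) : F) a (2 * j + 2)))) with hp
    have hc : Commute (Polynomial.aeval X p) (dunkl X Y (cen ((2 * n + 1 : ℕ) : F) a b c) 1) := by
      refine commute_aeval_prod X _ fun j _ => h.pair.commute_dunkl (by norm_num) ?_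
      rw [show 2 * j + 2 = 2 * (j + 1) by ring, th_even, th_odd]; push_cast; field_simp; ring
    have key := h.pair.weight_dunkl (by norm_num) h.weight h₁ hr₀ hr₁ hc
    have e3 : 2 * n + 1 - (2 * i + 1) = 2 * (n - i) := by omega
    have e4 : ((n - i : ℕ) : F) = n - i := Nat.cast_sub (by omega)
    have e5 : 2 * i + 1 + 1 = 2 * (i + 1) := by ring
    -- The relation for Z + Y is exactly r((X - θ_0)(X - θ_d) y) = 0. Hence the constant term of the
    -- last linear factor does not matter, the two values of r agree, and so do the two even-indexed
    -- φ.
    have hy : r (Polynomial.aeval X (((Polynomial.X - Polynomial.C (th ((2 * n + 1 : ℕ) : F) a 0)) *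
        (Polynomial.X - Polynomial.C (th ((2 * n + 1 : ℕ) : F) a (2 * n + 1)))) * p) v) = 0 := by
      rw [map_mul, Module.End.mul_apply, aeval_quadratic]
      simp only [map_sub, map_add, map_smul, smul_eq_mul]
      rw [th_odd]
      simp only [th, nu, cen] at key ⊢
      push_cast at key ⊢
      linear_combination key / 2
    rw [aeval_linear_mul, aeval_linear_mul, map_sub, map_sub, map_smul, map_smul, hy, e3, e5,
      ph_even, ph_even, e4]
    push_cast
    simp only [smul_zero]
    ring

/-- Descend from k = d, where the value is ∏ φ_i; each step down preserves non-vanishing by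
`weight_erase_succ`. -/
theorem weight_erase_ne_zero {d : ℕ} (hd : Odd d) {X Y : Module.End F V} {a b c : F} {v : V}
    (h : IsHighest X Y (d : F) a b c v) (hend : chain X (th (d : F) a) v (d + 1) = 0)
    (hφ : ∀ i, 1 ≤ i → i ≤ d → ph (d : F) a b c i ≠ 0)
    (hφ' : ∀ i, 1 ≤ i → i ≤ d → ph (d : F) (-a) b c i ≠ 0)
    {r : V →ₗ[F] F} (hr₀ : ∀ w, r (Y w) = th (d : F) b 0 * r w)
    (hr₁ : ∀ w, r (X (Y w)) = th (d : F) b 1 * r (X w) + nu (d : F) a b c * r w)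
    (hr₂ : r (chain X (th (d : F) a) v d) = ∏ i ∈ Finset.range d, ph (d : F) a b c (i + 1))
    {k : ℕ} (hk : k ≤ d) :
    r (Polynomial.aeval X (lprod (th (d : F) a) ((Finset.range (d + 1)).erase k)) v) ≠ 0 := by
  refine Nat.decreasingInduction (motive := fun k _ => r (Polynomial.aeval X
    (lprod (th (d : F) a) ((Finset.range (d + 1)).erase k)) v) ≠ 0) ?_ ?_ hk
  · intro k hk ih e
    have := weight_erase_succ hd h hend hr₀ hr₁ hk
    rw [e, zero_mul] at this
    exact mul_ne_zero ih (hφ' _ (by omega) (by omega)) this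
  · rw [Finset.range_add_one, Finset.erase_insert (by simp), ← chain_eq_aeval, hr₂]
    refine Finset.prod_ne_zero_iff.2 fun i hi => hφ _ (by omega) ?_
    have := Finset.mem_range.1 hi
    omega

/-- Under the stated non-vanishing conditions, a non-zero subspace that is invariant under `X` and
`Y` is the whole space. -/
theorem eq_top_of_invariant {d : ℕ} (hd : Odd d) {X Y : Module.End F V} {a b c : F} {v : V}
    (h : IsHighest X Y (d : F) a b c v) (B : Module.Basis (Fin (d + 1)) F V)
    (hB : ∀ i : Fin (d + 1), B i = chain X (th (d : F) a) v i)
    (hend : chain X (th (d : F) a) v (d + 1) = 0)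
    (hφ : ∀ i, 1 ≤ i → i ≤ d → ph (d : F) a b c i ≠ 0)
    (hφ' : ∀ i, 1 ≤ i → i ≤ d → ph (d : F) (-a) b c i ≠ 0)
    {W : Submodule F V} (hX : ∀ w ∈ W, X w ∈ W) (hY : ∀ w ∈ W, Y w ∈ W) (hW : W ≠ ⊥) : W = ⊤ := by
  obtain ⟨r, hr₀, hr₁, hr₃, hr₂⟩ := exists_weight hd h B hB hend
  suffices hv : v ∈ W by
    rw [eq_top_iff, ← B.span_eq, Submodule.span_le]
    rintro _ ⟨i, rfl⟩
    rw [hB]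
    exact chain_mem hX hv _
  obtain ⟨w, hw, hw0⟩ := W.ne_bot_iff.1 hW
  suffices ∃ z ∈ W, r z ≠ 0 by
    obtain ⟨z, hz, hrz⟩ := this
    have := aeval_mem hY (lprod (th (d : F) b) (Finset.Ico 1 (d + 1))) hz
    rw [hr₃] at this
    exact (W.smul_mem_iff hrz).1 this
  classical
  have hne : (Finset.univ.filter fun i => B.repr w i ≠ 0).Nonempty := by
    by_contra hn
    rw [Finset.not_nonempty_iff_eq_empty, Finset.filter_eq_empty_iff] at hn
    apply hw0
    apply B.repr.map_eq_zero_iff.1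
    ext i
    simpa using hn (Finset.mem_univ i)
  -- For the lowest index j in the support of w, ∏_{i>j}(X - θ_i) kills all later basis vectors, by
  -- the vanishing of the full product on v, and sends the j-th one to ∏_{i≠j}(X - θ_i) v.
  obtain ⟨j, hj, hmin⟩ := Finset.exists_min_image _ id hne
  have hj' : B.repr w j ≠ 0 := (Finset.mem_filter.1 hj).2
  refine ⟨Polynomial.aeval X (lprod (th (d : F) a) (Finset.Ico (j + 1) (d + 1))) w,
    aeval_mem hX _ hw, ?_⟩
  have hdisj : Disjoint (Finset.range j) (Finset.Ico ((j : ℕ) + 1) (d + 1)) :=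
    Finset.disjoint_left.2 fun x hx hx' => by
      rw [Finset.mem_range] at hx; rw [Finset.mem_Ico] at hx'; omega
  have hu : Finset.range j ∪ Finset.Ico ((j : ℕ) + 1) (d + 1) = (Finset.range (d + 1)).erase j := by
    ext x
    have := j.2
    simp only [Finset.mem_union, Finset.mem_range, Finset.mem_Ico, Finset.mem_erase]
    omega
  have hz : ∀ i, j < i → Polynomial.aeval X (lprod (th (d : F) a) (Finset.Ico ((j : ℕ) + 1) (d + 1)))
      (B i) = 0 := by
    intro i hi
    have hi' : (j : ℕ) + 1 ≤ i := hi
    have hi2 := i.2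
    rw [hB, chain_eq_aeval, ← Module.End.mul_apply, ← map_mul, lprod, lprod,
      ← Finset.prod_range_mul_prod_Ico _ hi', ← mul_assoc, mul_comm (∏ x ∈ Finset.Ico _ _, _),
      Finset.prod_range_mul_prod_Ico _ (by omega : (j : ℕ) + 1 ≤ d + 1), mul_comm, map_mul,
      Module.End.mul_apply, ← lprod, ← lprod, ← chain_eq_aeval, hend, map_zero]
  have hsum : Polynomial.aeval X (lprod (th (d : F) a) (Finset.Ico ((j : ℕ) + 1) (d + 1))) w =
      B.repr w j • Polynomial.aeval X (lprod (th (d : F) a) ((Finset.range (d + 1)).erase j)) v := by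
    conv_lhs => rw [← B.sum_repr w]
    rw [map_sum, Finset.sum_eq_single j]
    · rw [map_smul, hB, chain_eq_aeval, ← Module.End.mul_apply, ← map_mul, mul_comm, lprod, lprod,
        ← Finset.prod_union hdisj, hu, lprod]
    · intro i _ hij
      rcases lt_or_gt_of_ne hij with hlt | hgt
      · have : B.repr w i = 0 := by
          by_contra hne
          exact absurd (hmin i (Finset.mem_filter.2 ⟨Finset.mem_univ _, hne⟩)) (not_le.2 hlt)
        rw [this, zero_smul, map_zero]
      · rw [map_smul, hz i hgt, smul_zero]
    · simp
  rw [hsum, map_smul, smul_eq_mul]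
  exact mul_ne_zero hj' (weight_erase_ne_zero hd h hend hφ hφ' hr₀ hr₁ hr₂ (by have := j.2; omega))

end Irreducible

/-! ### From an irreducible pair to its parameters -/

section Classification

variable {F V : Type*} [Field F] [AddCommGroup V] [Module F V]

theorem sum_th [CharZero F] (δ a : F) (m : ℕ) : ∑ i ∈ Finset.range (2 * m), th δ a i = -m := by
  induction m with
  | zero => simp
  | succ m ih =>
    rw [mul_add, mul_one, Finset.sum_range_succ, Finset.sum_range_succ, ih, th_even, th_odd]
    push_cast
    field_simp
    ring

theorem sum_th_of_odd [CharZero F] {d : ℕ} (hd : Odd d) (δ a : F) :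
    ∑ i : Fin (d + 1), th δ a i = -((d : F) + 1) / 2 := by
  obtain ⟨n, rfl⟩ := hd
  have := sum_th δ a (n + 1)
  rw [show 2 * (n + 1) = 2 * n + 1 + 1 by ring, ← Fin.sum_univ_eq_sum_range] at this
  rw [this]
  push_cast
  field_simp
  ring

/-- The sequence depends on its initial term θ alone, so it is known before δ is. -/
theorem th_add_half [CharZero F] (δ θ : F) (i : ℕ) : th δ (θ + δ / 2) i = (-1) ^ i * (θ + i) := by
  simp only [th]; field_simp; ring

/-- Otherwise θ ↦ -1 - θ ↦ 1 - (-1 - θ) = θ + 2 preserves the spectrum, which would be infinite. -/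
theorem exists_hasEigenvalue_not_hasEigenvalue [IsAlgClosed F] [CharZero F] [FiniteDimensional F V]
    [Nontrivial V] (Y : Module.End F V) :
    ∃ θ, Y.HasEigenvalue θ ∧ (¬ Y.HasEigenvalue (1 - θ) ∨ ¬ Y.HasEigenvalue (-1 - θ)) := by
  by_contra! hcon
  obtain ⟨θ, hθ⟩ := Module.End.exists_eigenvalue Y
  have hall : ∀ n : ℕ, Y.HasEigenvalue (θ + 2 * n) := by
    intro n
    induction n with
    | zero => simpa using hθ
    | succ n ih =>
      have := (hcon _ (hcon _ ih).2).1
      convert this using 1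
      push_cast
      ring
  refine Set.infinite_of_injective_forall_mem (f := fun n : ℕ => θ + 2 * (n : F)) ?_
    (s := {μ | Y.HasEigenvalue μ}) hall ?_
  · intro i j hij
    simpa using hij
  · exact Module.End.finite_hasEigenvalue Y

/-- The space `V` is irreducible under `X` and `Y`. -/
def IsIrred (X Y : Module.End F V) : Prop :=
  Nontrivial V ∧
    ∀ W : Submodule F V, (∀ w ∈ W, X w ∈ W) → (∀ w ∈ W, Y w ∈ W) → W = ⊥ ∨ W = ⊤

theorem IsIrred.swap {X Y : Module.End F V} (h : IsIrred X Y) : IsIrred Y X :=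
  ⟨h.1, fun W hX hY => h.2 W hY hX⟩

theorem exists_chain_mem_span [FiniteDimensional F V] (X : Module.End F V) (t : ℕ → F) (v : V) :
    ∃ m ≤ Module.finrank F V,
      chain X t v m ∈ Submodule.span F (Set.range fun i : Fin m => chain X t v i) := by
  by_contra! hcon
  have key : ∀ m ≤ Module.finrank F V + 1,
      m ≤ Module.finrank F (Submodule.span F (Set.range fun i : Fin m => chain X t v i)) := by
    intro m hm
    induction m with
    | zero => simp
    | succ m ih =>
      refine Nat.succ_le_of_lt ((ih (by omega)).trans_lt (Submodule.finrank_lt_finrank_of_lt ?_))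
      refine lt_of_le_of_ne (Submodule.span_mono ?_) ?_
      · rintro _ ⟨i, rfl⟩
        exact ⟨i.castSucc, rfl⟩
      · intro e
        apply hcon m (by omega)
        rw [e]
        exact Submodule.subset_span ⟨Fin.last m, rfl⟩
  have := (key _ le_rfl).trans (Submodule.finrank_le _)
  omega

variable [CharZero F]

/-- As soon as one chain vector depends on the earlier ones, their span is invariant under X and Y,
hence everything; counting dimensions makes them a basis. -/
theorem IsHighest.exists_basis [FiniteDimensional F V] {X Y : Module.End F V} (hirr : IsIrred X Y)
    {δ a b c : F} {v : V} (h : IsHighest X Y δ a b c v) (hv : v ≠ 0) {n : ℕ}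
    (hn : Module.finrank F V = n) :
    ∃ B : Module.Basis (Fin n) F V, ∀ i, B i = chain X (th δ a) v i := by
  obtain ⟨m, hm, hmem⟩ := exists_chain_mem_span X (th δ a) v
  set U := Submodule.span F (Set.range fun i : Fin m => chain X (th δ a) v i) with hU
  have hin : ∀ i < m, chain X (th δ a) v i ∈ U := fun i hi => Submodule.subset_span ⟨⟨i, hi⟩, rfl⟩
  have hin' : ∀ i ≤ m, chain X (th δ a) v i ∈ U := fun i hi => by
    rcases hi.lt_or_eq with hi | rfl
    · exact hin i hi
    · exact hmem
  have hXU : ∀ w ∈ U, X w ∈ U := by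
    intro w hw
    induction hw using Submodule.span_induction with
    | mem x hx =>
      obtain ⟨i, rfl⟩ := hx
      simp only [apply_chain]
      exact U.add_mem (hin' _ i.2) (U.smul_mem _ (hin _ i.2))
    | zero => simp
    | add x y _ _ hx hy => rw [map_add]; exact U.add_mem hx hy
    | smul s x _ hx => rw [map_smul]; exact U.smul_mem _ hx
  have hYU : ∀ w ∈ U, Y w ∈ U := by
    intro w hw
    induction hw using Submodule.span_induction with
    | mem x hx =>
      obtain ⟨⟨i, hi⟩, rfl⟩ := hx
      cases i with
      | zero =>
        simp only [chain, h.weight]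
        exact U.smul_mem _ (hin 0 hi)
      | succ i =>
        simp only [h.apply_chain_right]
        exact U.add_mem (U.smul_mem _ (hin _ hi)) (U.smul_mem _ (hin _ (by omega)))
    | zero => simp
    | add x y _ _ hx hy => rw [map_add]; exact U.add_mem hx hy
    | smul s x _ hx => rw [map_smul]; exact U.smul_mem _ hx
  have hvU : v ∈ U := hin' 0 (Nat.zero_le _)
  have htop : U = ⊤ := by
    refine (hirr.2 U hXU hYU).resolve_left fun e => hv ?_
    rw [e] at hvU
    simpa using hvU
  have hle : n ≤ m := by
    have := finrank_range_le_card (R := F) (fun i : Fin m => chain X (th δ a) v i)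
    rw [Set.finrank, ← hU, htop, finrank_top, hn, Fintype.card_fin] at this
    exact this
  obtain rfl : m = n := by omega
  exact ⟨basisOfTopLeSpanOfCardEqFinrank _ htop.ge (by rw [hn, Fintype.card_fin]),
    fun i => by rw [coe_basisOfTopLeSpanOfCardEqFinrank]⟩

theorem IsHighest.trace_right {X Y : Module.End F V} {δ a b c : F} {v : V}
    (h : IsHighest X Y δ a b c v) {d : ℕ} (hd : Odd d) (B : Module.Basis (Fin (d + 1)) F V)
    (hB : ∀ i : Fin (d + 1), B i = chain X (th δ a) v i) :
    LinearMap.trace F V Y = -((d : F) + 1) / 2 := by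
  rw [LinearMap.trace_eq_matrix_trace F B, ← sum_th_of_odd hd δ b]
  refine Finset.sum_congr rfl fun i _ => ?_
  rw [Matrix.diag_apply, LinearMap.toMatrix_apply, hB]
  obtain ⟨i, hi⟩ := i
  cases i with
  | zero =>
    simp only [chain, h.weight, map_smul]
    have : v = B ⟨0, hi⟩ := by rw [hB]; rfl
    rw [this]
    simp
  | succ i =>
    simp only [h.apply_chain_right, map_add, map_smul]
    rw [← hB ⟨i + 1, hi⟩, ← hB ⟨i, by omega⟩]
    simp

/-- In this basis X is lower bidiagonal except for its last column, where the chain vector of index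
d+1, not yet known to vanish, contributes its last coordinate. -/
theorem trace_eq_of_chain_basis {X : Module.End F V} {δ a : F} {v : V} {d : ℕ} (hd : Odd d) (B : Module.Basis (Fin (d + 1)) F V)
    (hB : ∀ i : Fin (d + 1), B i = chain X (th δ a) v i) :
    LinearMap.trace F V X = -((d : F) + 1) / 2 +
      B.repr (chain X (th δ a) v (d + 1)) (Fin.last d) := by
  rw [LinearMap.trace_eq_matrix_trace F B, ← sum_th_of_odd hd δ a, Matrix.trace,
    Fin.sum_univ_castSucc, Fin.sum_univ_castSucc, add_assoc]
  congr 1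
  · refine Finset.sum_congr rfl fun i _ => ?_
    rw [Matrix.diag_apply, LinearMap.toMatrix_apply, hB, apply_chain]
    have : chain X (th δ a) v (i.castSucc + 1) = B i.succ := by rw [hB]; rfl
    rw [this, ← hB]
    simp [Fin.ext_iff]
  · rw [Matrix.diag_apply, LinearMap.toMatrix_apply, hB, apply_chain, ← hB]
    simp [add_comm]

theorem IsHighest.aeval_right {X Y : Module.End F V} {δ a b c : F} {v : V}
    (h : IsHighest X Y δ a b c v) {n : ℕ} (B : Module.Basis (Fin n) F V)
    (hB : ∀ i : Fin n, B i = chain X (th δ a) v i) :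
    Polynomial.aeval Y (lprod (th δ b) (Finset.range n)) = 0 := by
  refine B.ext fun i => ?_
  have := i.2
  rw [hB, LinearMap.zero_apply, lprod, ← Finset.prod_range_mul_prod_Ico _ (show (i : ℕ) + 1 ≤ n by omega),
    mul_comm, map_mul, Module.End.mul_apply, ← lprod, ← lprod,
    aeval_lprod_range_chain (w := chain X (th δ a) v) h.weight h.apply_chain_right, map_zero]

/-- Y is upper triangular in the chain basis, so the last coordinate is an eigenvector of the dual
action. -/
theorem IsHighest.coord_last_comp {X Y : Module.End F V} {δ a b c : F} {v : V}
    (h : IsHighest X Y δ a b c v) {d : ℕ} (hd : Odd d) (B : Module.Basis (Fin (d + 1)) F V)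
    (hB : ∀ i : Fin (d + 1), B i = chain X (th δ a) v i) :
    B.coord (Fin.last d) ∘ₗ Y = th δ b d • B.coord (Fin.last d) := by
  have hc : ∀ i, i ≠ Fin.last d → B.coord (Fin.last d) (B i) = 0 := fun i hi => by
    rw [B.coord_apply, B.repr_self, Finsupp.single_eq_of_ne hi.symm]
  refine B.ext fun i => ?_
  obtain ⟨i, hi⟩ := i
  rw [LinearMap.comp_apply, LinearMap.smul_apply, hB]
  cases i with
  | zero =>
    have hw : Y (chain X (th δ a) v 0) = th δ b 0 • chain X (th δ a) v 0 := h.weight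
    simp only
    rw [hw, ← hB ⟨0, hi⟩]
    have : (⟨0, hi⟩ : Fin (d + 1)) ≠ Fin.last d := by
      intro e
      have := congrArg Fin.val e
      have := hd.pos
      simp at *
      omega
    rw [map_smul, hc _ this, smul_zero, smul_zero]
  | succ i =>
    simp only
    rw [h.apply_chain_right, ← hB ⟨i + 1, hi⟩, ← hB ⟨i, by omega⟩]
    have h2 : (⟨i, by omega⟩ : Fin (d + 1)) ≠ Fin.last d := by
      intro e
      have := congrArg Fin.val e
      simp at this
      omega
    rw [map_add, map_smul, map_smul, hc _ h2, smul_zero, add_zero]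
    by_cases e : i + 1 = d
    · simp only [e]
    · have h1 : (⟨i + 1, hi⟩ : Fin (d + 1)) ≠ Fin.last d := by
        intro e'
        exact e (congrArg Fin.val e')
      rw [hc _ h1, smul_zero, smul_zero]

/-- The trace kills the last coordinate of the chain vector of index d+1. Applying Y to that vector
and taking the last coordinate leaves φ_{d+1} = (d+1)(δ - d) = 0. -/
theorem IsHighest.eq_of_trace {X Y : Module.End F V} {δ a b c : F} {v : V}
    (h : IsHighest X Y δ a b c v) {d : ℕ} (hd : Odd d) (B : Module.Basis (Fin (d + 1)) F V)
    (hB : ∀ i : Fin (d + 1), B i = chain X (th δ a) v i)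
    (ht : LinearMap.trace F V X = -((d : F) + 1) / 2) : δ = d := by
  have h0 : B.coord (Fin.last d) (chain X (th δ a) v (d + 1)) = 0 := by
    rw [trace_eq_of_chain_basis hd B hB] at ht
    simpa using ht
  have hY := h.coord_last_comp hd B hB
  have e := LinearMap.congr_fun hY (chain X (th δ a) v (d + 1))
  rw [LinearMap.comp_apply, LinearMap.smul_apply, h.apply_chain_right, map_add, map_smul, map_smul,
    h0] at e
  have hlast : B.coord (Fin.last d) (chain X (th δ a) v d) = 1 := by
    have := hB (Fin.last d)
    rw [Fin.val_last] at this
    rw [← this]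
    simp
  rw [hlast] at e
  obtain ⟨n, rfl⟩ := hd
  have hp := ph_even δ a b c (n + 1)
  rw [show 2 * (n + 1) = 2 * n + 1 + 1 by ring] at hp
  rw [hp] at e
  simp only [mul_zero, zero_add, smul_eq_mul, mul_one] at e
  have hne : (2 * ((n + 1 : ℕ) : F)) ≠ 0 := by
    exact_mod_cast (by omega : 2 * (n + 1) ≠ 0)
  have := (mul_eq_zero.1 e).resolve_left hne
  push_cast at this ⊢
  linear_combination this

/-- With b = θ + δ/2 the terms in δ² cancel in the equation for κ + λ, which becomes linear in δ
with leading coefficient 1 - 2θ. Then a and c are square roots. -/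
theorem IsPair.exists_parameters [IsAlgClosed F] {X Y : Module.End F V} {κ l m : F}
    (h : IsPair X Y κ l m) {θ : F} (hθ : θ ≠ 1 / 2) :
    ∃ δ a c : F, IsEPair X Y δ a (θ + δ / 2) c ∧ κ + l = (δ + 1) ^ 2 / 2 - 2 * (θ + δ / 2) ^ 2 := by
  have hθ' : 2 * θ - 1 ≠ 0 := fun e => hθ (by linear_combination e / 2)
  obtain ⟨δ, hδ⟩ : ∃ δ : F, (2 * θ - 1) * δ = - (κ + l) - 2 * θ ^ 2 + 1 / 2 :=
    ⟨_, mul_div_cancel₀ _ hθ'⟩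
  obtain ⟨a, ha⟩ := IsAlgClosed.exists_pow_nat_eq ((δ + 1) ^ 2 / 4 - (κ + m) / 2) (n := 2) (by simp)
  obtain ⟨c, hc⟩ := IsAlgClosed.exists_pow_nat_eq ((δ + 1) ^ 2 / 4 - (l + m) / 2) (n := 2) (by simp)
  have e : κ + l = (δ + 1) ^ 2 / 2 - 2 * (θ + δ / 2) ^ 2 := by
    linear_combination hδ
  refine ⟨δ, a, c, ?_, e⟩
  have e1 : cen δ a (θ + δ / 2) c = κ := by
    simp only [cen]; linear_combination hc - ha - e / 2
  have e2 : cen δ (θ + δ / 2) c a = l := by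
    simp only [cen]; linear_combination ha - hc - e / 2
  have e3 : cen δ c a (θ + δ / 2) = m := by
    simp only [cen]; linear_combination -ha - hc + e / 2
  rw [IsEPair, e1, e2, e3]
  exact h

/-- The first two conclusions do not involve the unknown δ, so they can be used for X after
exchanging X and Y; the third then becomes available. -/
theorem IsPair.eigenvalue_data [IsAlgClosed F] [FiniteDimensional F V] {X Y : Module.End F V}
    {κ l m : F} (h : IsPair X Y κ l m) (hirr : IsIrred X Y) {d : ℕ} (hd : Odd d)
    (hdim : Module.finrank F V = d + 1) {θ : F} (hθ : Y.HasEigenvalue θ)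
    (hθ' : ¬ Y.HasEigenvalue (1 - θ)) :
    LinearMap.trace F V Y = -((d : F) + 1) / 2 ∧
      Polynomial.aeval Y (lprod (th (d : F) (θ + d / 2)) (Finset.range (d + 1))) = 0 ∧
      (LinearMap.trace F V X = -((d : F) + 1) / 2 →
        κ + l = ((d : F) + 1) ^ 2 / 2 - 2 * (θ + d / 2) ^ 2) := by
  have hne : θ ≠ 1 / 2 := by
    rintro rfl
    apply hθ'
    convert hθ using 1
    norm_num
  obtain ⟨δ, a, c, hp, e⟩ := h.exists_parameters hne
  obtain ⟨v, hv⟩ := hθ.exists_hasEigenvector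
  have h0 : th δ (θ + δ / 2) 0 = θ := by simp [th_add_half]
  have hw : Y v = th δ (θ + δ / 2) 0 • v := by rw [h0]; exact hv.apply_eq_smul
  have hh : IsHighest X Y δ a (θ + δ / 2) c v :=
    ⟨hp, hw, apply_apply_of_not_hasEigenvalue hp hw (by rwa [h0]) hv.2⟩
  obtain ⟨B, hB⟩ := hh.exists_basis hirr hv.2 hdim
  refine ⟨hh.trace_right hd B hB, ?_, fun ht => ?_⟩
  · have := hh.aeval_right B hB
    have ef : th δ (θ + δ / 2) = th (d : F) (θ + d / 2) := by
      funext i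
      rw [th_add_half, th_add_half]
    rwa [ef] at this
  · have := hh.eq_of_trace hd B hB ht
    rwa [this] at e

/-- The eigenvalue of Y fixes b and that of X fixes a. The polynomial identity for X, obtained by
the exchange, terminates the chain. -/
theorem IsPair.exists_isHighest [IsAlgClosed F] [FiniteDimensional F V] {X Y : Module.End F V}
    {κ l m : F} (h : IsPair X Y κ l m) (hirr : IsIrred X Y) {d : ℕ} (hd : Odd d)
    (hdim : Module.finrank F V = d + 1) {θ η : F} (hθ : Y.HasEigenvalue θ)
    (hθ' : ¬ Y.HasEigenvalue (1 - θ)) (hη : X.HasEigenvalue η) (hη' : ¬ X.HasEigenvalue (1 - η)) :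
    ∃ a b c : F, ∃ v ≠ 0, κ = cen (d : F) a b c ∧ IsHighest X Y (d : F) a b c v ∧
      chain X (th (d : F) a) v (d + 1) = 0 := by
  obtain ⟨tY, _, kY⟩ := h.eigenvalue_data hirr hd hdim hθ hθ'
  obtain ⟨tX, pX, kX⟩ := h.swap.eigenvalue_data hirr.swap hd hdim hη hη'
  have k1 := kY tX
  have k2 := kX tY
  obtain ⟨c, hc⟩ := IsAlgClosed.exists_pow_nat_eq
    (((d : F) + 1) ^ 2 / 4 - (l + m) / 2) (n := 2) (by simp)
  have e1 : cen (d : F) (η + d / 2) (θ + d / 2) c = κ := by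
    simp only [cen]; linear_combination hc - k1 / 2 - k2 / 2
  have e2 : cen (d : F) (θ + d / 2) c (η + d / 2) = l := by
    simp only [cen]; linear_combination k2 / 2 - hc - k1 / 2
  have e3 : cen (d : F) c (η + d / 2) (θ + d / 2) = m := by
    simp only [cen]; linear_combination k1 / 2 - hc - k2 / 2
  have hp : IsEPair X Y (d : F) (η + d / 2) (θ + d / 2) c := by
    rw [IsEPair, e1, e2, e3]; exact h
  obtain ⟨v, hv⟩ := hθ.exists_hasEigenvector
  have h0 : th (d : F) (θ + d / 2) 0 = θ := by simp [th_add_half]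
  have hw : Y v = th (d : F) (θ + d / 2) 0 • v := by rw [h0]; exact hv.apply_eq_smul
  refine ⟨η + d / 2, θ + d / 2, c, v, hv.2, e1.symm,
    ⟨hp, hw, apply_apply_of_not_hasEigenvalue hp hw (by rwa [h0]) hv.2⟩, ?_⟩
  rw [chain_eq_aeval, pX, LinearMap.zero_apply]

end Classification

/-! ### Uniqueness, sign changes and necessity of the parameter conditions -/

section HighestWeight

variable {F V V' : Type*} [Field F] [AddCommGroup V] [Module F V] [AddCommGroup V'] [Module F V']

theorem th_neg_reflect {d : ℕ} (hd : Odd d) [CharZero F] (a : F) {j : ℕ} (hj : j ≤ d) :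
    th (d : F) (-a) j = th (d : F) a (d - j) := by
  have hs : (-1 : F) ^ (d - j) = -(-1) ^ j := by
    have h : (-1 : F) ^ (d - j) * (-1) ^ j = -1 := by
      rw [← pow_add, Nat.sub_add_cancel hj, hd.neg_one_pow]
    have h2 : ((-1 : F) ^ j) * (-1) ^ j = 1 := by
      rw [← pow_add, Even.neg_one_pow ⟨j, rfl⟩]
    linear_combination (-1) ^ j * h - (-1) ^ (d - j) * h2
  simp only [th, hs, Nat.cast_sub hj]
  ring

theorem lprod_th_neg {d : ℕ} (hd : Odd d) [CharZero F] (a : F) :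
    lprod (th (d : F) (-a)) (Finset.range (d + 1)) = lprod (th (d : F) a) (Finset.range (d + 1)) := by
  rw [lprod, lprod, ← Finset.prod_range_reflect]
  refine Finset.prod_congr rfl fun j hj => ?_
  have := Finset.mem_range.1 hj
  rw [th_neg_reflect hd a (by omega), show d - (d + 1 - 1 - j) = j by omega]

/-- The operators `X`, `Y`, `Z` have a highest weight vector with the parameters `(a, b, c)` that
generates a quotient of `E_d(a,b,c)`. -/
def HasHighest (X Y Z : Module.End F V) (d : ℕ) (a b c : F) : Prop :=
  (∀ w, Z w = X (Y w) + Y (X w) - cen (d : F) a b c • w) ∧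
    ∃ v ≠ 0, IsHighest X Y (d : F) a b c v ∧ chain X (th (d : F) a) v (d + 1) = 0

/-- The same v works: ν and the central scalars are even in a, and a ↦ -a only reverses the list
θ_0, …, θ_d. -/
theorem HasHighest.neg_left [CharZero F] {X Y Z : Module.End F V} {d : ℕ} (hd : Odd d) {a b c : F}
    (h : HasHighest X Y Z d a b c) : HasHighest X Y Z d (-a) b c := by
  obtain ⟨hZ, v, hv, hh, he⟩ := h
  have e1 : cen (d : F) (-a) b c = cen (d : F) a b c := by simp only [cen]; ring
  have e2 : cen (d : F) b c (-a) = cen (d : F) b c a := by simp only [cen]; ring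
  have e3 : cen (d : F) c (-a) b = cen (d : F) c a b := by simp only [cen]; ring
  refine ⟨by rwa [e1], v, hv, ⟨?_, hh.weight, ?_⟩, ?_⟩
  · rw [IsEPair, e1, e2, e3]; exact hh.pair
  · rw [nu_neg_left]; exact hh.next
  · rw [chain_eq_aeval, lprod_th_neg hd, ← chain_eq_aeval, he]

theorem HasHighest.neg_right [CharZero F] {X Y Z : Module.End F V} {d : ℕ} {a b c : F}
    (h : HasHighest X Y Z d a b c) : HasHighest X Y Z d a b (-c) := by
  obtain ⟨hZ, v, hv, hh, he⟩ := h
  have e1 : cen (d : F) a b (-c) = cen (d : F) a b c := by simp only [cen]; ring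
  have e2 : cen (d : F) b (-c) a = cen (d : F) b c a := by simp only [cen]; ring
  have e3 : cen (d : F) (-c) a b = cen (d : F) c a b := by simp only [cen]; ring
  have e4 : nu (d : F) a b (-c) = nu (d : F) a b c := by simp only [nu]; ring
  refine ⟨by rwa [e1], v, hv, ⟨?_, hh.weight, ?_⟩, he⟩
  · rw [IsEPair, e1, e2, e3]; exact hh.pair
  · rw [e4]; exact hh.next

variable [CharZero F]

/-- Pairwise sums of the three central scalars isolate a², b², c². -/
theorem HasHighest.sq_eq {X Y Z : Module.End F V} {d : ℕ} {a b c a' b' c' : F}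
    (h : HasHighest X Y Z d a b c) (h' : HasHighest X Y Z d a' b' c') :
    a ^ 2 = a' ^ 2 ∧ b ^ 2 = b' ^ 2 ∧ c ^ 2 = c' ^ 2 := by
  obtain ⟨hZ, v, hv, hh, _⟩ := h
  obtain ⟨hZ', _, _, hh', _⟩ := h'
  have e1 : cen (d : F) a b c = cen (d : F) a' b' c' := by
    have := hZ v
    rw [hZ' v] at this
    exact smul_left_injective F hv (by simpa using this.symm)
  have e2 : cen (d : F) b c a = cen (d : F) b' c' a' := by
    have := hh.pair.left v
    rw [hh'.pair.left v, e1] at this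
    exact smul_left_injective F hv (by simpa using this.symm)
  have e3 : cen (d : F) c a b = cen (d : F) c' a' b' := by
    have := hh.pair.right v
    rw [hh'.pair.right v, e1] at this
    exact smul_left_injective F hv (by simpa using this.symm)
  simp only [cen] at e1 e2 e3
  refine ⟨?_, ?_, ?_⟩
  · linear_combination -(e1 + e3) / 2
  · linear_combination -(e1 + e2) / 2
  · linear_combination -(e2 + e3) / 2

variable [FiniteDimensional F V] [FiniteDimensional F V']

/-- If φ_i = 0, the chain vectors of index at least i span a proper non-zero invariant subspace. -/
theorem HasHighest.ph_ne_zero {X Y Z : Module.End F V} {d : ℕ} {a b c : F}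
    (h : HasHighest X Y Z d a b c) (hirr : IsIrred X Y) (hdim : Module.finrank F V = d + 1)
    {i : ℕ} (hi : 1 ≤ i) (hid : i ≤ d) : ph (d : F) a b c i ≠ 0 := by
  obtain ⟨_, v, hv, hh, he⟩ := h
  obtain ⟨B, hB⟩ := hh.exists_basis hirr hv hdim
  intro hz
  set W := Submodule.span F (Set.range fun j => chain X (th (d : F) a) v (i + j)) with hW
  have hin : ∀ j, chain X (th (d : F) a) v (i + j) ∈ W := fun j => Submodule.subset_span ⟨j, rfl⟩
  have hXW : ∀ w ∈ W, X w ∈ W := by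
    intro w hw
    induction hw using Submodule.span_induction with
    | mem x hx =>
      obtain ⟨j, rfl⟩ := hx
      simp only [apply_chain]
      exact W.add_mem (hin (j + 1)) (W.smul_mem _ (hin j))
    | zero => simp
    | add x y _ _ hx hy => rw [map_add]; exact W.add_mem hx hy
    | smul s x _ hx => rw [map_smul]; exact W.smul_mem _ hx
  have hYW : ∀ w ∈ W, Y w ∈ W := by
    intro w hw
    induction hw using Submodule.span_induction with
    | mem x hx =>
      obtain ⟨j, rfl⟩ := hx
      cases j with
      | zero =>
        obtain ⟨k, rfl⟩ : ∃ k, i = k + 1 := ⟨i - 1, by omega⟩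
        simp only [add_zero]
        rw [hh.apply_chain_right, hz, zero_smul, add_zero]
        exact W.smul_mem _ (hin 0)
      | succ j =>
        simp only [← add_assoc]
        rw [hh.apply_chain_right]
        exact W.add_mem (W.smul_mem _ (hin (j + 1))) (W.smul_mem _ (hin j))
    | zero => simp
    | add x y _ _ hx hy => rw [map_add]; exact W.add_mem hx hy
    | smul s x _ hx => rw [map_smul]; exact W.smul_mem _ hx
  rcases hirr.2 W hXW hYW with e | e
  · have := hin 0
    rw [e, Submodule.mem_bot, add_zero, ← hB ⟨i, by omega⟩] at this
    exact B.ne_zero _ this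
  · have hle : W ≤ LinearMap.ker (B.coord 0) := by
      rw [hW, Submodule.span_le]
      rintro _ ⟨j, rfl⟩
      simp only [SetLike.mem_coe, LinearMap.mem_ker]
      by_cases hj : i + j ≤ d
      · rw [← hB ⟨i + j, by omega⟩, B.coord_apply, B.repr_self, Finsupp.single_eq_of_ne]
        intro e'
        have := congrArg Fin.val e'
        simp at this
        omega
      · obtain ⟨k, hk⟩ : ∃ k, i + j = d + 1 + k := ⟨i + j - (d + 1), by omega⟩
        have : ∀ k, chain X (th (d : F) a) v (d + 1 + k) = 0 := by
          intro k
          induction k with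
          | zero => exact he
          | succ k ih => rw [← add_assoc, chain, ih]; simp
        rw [hk, this, map_zero]
    have : B 0 ∈ W := by rw [e]; trivial
    have := hle this
    simp at this

theorem HasHighest.exists_equiv {X Y Z : Module.End F V} {X' Y' Z' : Module.End F V'} {d : ℕ}
    {a b c : F} (h : HasHighest X Y Z d a b c) (hirr : IsIrred X Y)
    (hdim : Module.finrank F V = d + 1) (h' : HasHighest X' Y' Z' d a b c) (hirr' : IsIrred X' Y')
    (hdim' : Module.finrank F V' = d + 1) :
    ∃ f : V ≃ₗ[F] V', ∀ w, f (X w) = X' (f w) ∧ f (Y w) = Y' (f w) ∧ f (Z w) = Z' (f w) := by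
  obtain ⟨hZ, v, hv, hh, he⟩ := h
  obtain ⟨hZ', v', hv', hh', he'⟩ := h'
  obtain ⟨B, hB⟩ := hh.exists_basis hirr hv hdim
  obtain ⟨B', hB'⟩ := hh'.exists_basis hirr' hv' hdim'
  set f := B.equiv B' (Equiv.refl _) with hf
  have hfc : ∀ n ≤ d, f (chain X (th (d : F) a) v n) = chain X' (th (d : F) a) v' n := by
    intro n hn
    rw [← hB ⟨n, by omega⟩, ← hB' ⟨n, by omega⟩, hf, Module.Basis.equiv_apply, Equiv.refl_apply]
  have hfc' : ∀ n ≤ d, f (chain X (th (d : F) a) v (n + 1)) = chain X' (th (d : F) a) v' (n + 1) := by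
    intro n hn
    rcases hn.lt_or_eq with hn | rfl
    · exact hfc _ hn
    · rw [he, he', map_zero]
  have hX : ∀ w, f (X w) = X' (f w) := by
    suffices e : f.toLinearMap ∘ₗ X = X' ∘ₗ f.toLinearMap from fun w => LinearMap.congr_fun e w
    refine B.ext fun i => ?_
    have hi : (i : ℕ) ≤ d := Nat.le_of_lt_succ i.2
    simp only [LinearMap.comp_apply, hB, apply_chain, LinearEquiv.coe_coe, map_add, map_smul,
      hfc' _ hi, hfc _ hi]
  have hY : ∀ w, f (Y w) = Y' (f w) := by
    suffices e : f.toLinearMap ∘ₗ Y = Y' ∘ₗ f.toLinearMap from fun w => LinearMap.congr_fun e w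
    refine B.ext fun i => ?_
    obtain ⟨i, hi⟩ := i
    cases i with
    | zero =>
      have := hfc 0 (Nat.zero_le _)
      simp only [chain] at this
      simp only [LinearMap.comp_apply, hB, LinearEquiv.coe_coe, chain, hh.weight, map_smul, this,
        hh'.weight]
    | succ i =>
      simp only [LinearMap.comp_apply, hB, LinearEquiv.coe_coe, hh.apply_chain_right, map_add,
        map_smul, hfc' i (by omega), hfc i (by omega), hh'.apply_chain_right]
  exact ⟨f, fun w => ⟨hX w, hY w, by rw [hZ, hZ', map_sub, map_add, hX, hY, hY, hX, map_smul]⟩⟩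

theorem HasHighest.trace {X Y Z : Module.End F V} {d : ℕ} (hd : Odd d) {a b c : F}
    (h : HasHighest X Y Z d a b c) (hirr : IsIrred X Y) (hdim : Module.finrank F V = d + 1) :
    LinearMap.trace F V X = -((d : F) + 1) / 2 ∧ LinearMap.trace F V Y = -((d : F) + 1) / 2 := by
  obtain ⟨_, v, hv, hh, he⟩ := h
  obtain ⟨B, hB⟩ := hh.exists_basis hirr hv hdim
  refine ⟨?_, hh.trace_right hd B hB⟩
  rw [trace_eq_of_chain_basis hd B hB, he]
  simp

/-- θ*_d for b is θ*_0 for -b, and it is an eigenvalue of Y by `coord_last_comp`. The condition `hb`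
keeps 1 - θ*_d out of the spectrum, so an eigenvector for θ*_d is a highest weight vector for -b.
The chain ends because v generates V under X, whence ∏(X - θ_i) = 0. -/
theorem HasHighest.neg_middle {X Y Z : Module.End F V} {d : ℕ} (hd : Odd d) {a b c : F}
    (h : HasHighest X Y Z d a b c) (hirr : IsIrred X Y) (hdim : Module.finrank F V = d + 1)
    (hb : ∀ i ≤ d, th (d : F) b i ≠ 1 - th (d : F) b d) : HasHighest X Y Z d a (-b) c := by
  obtain ⟨hZ, v, hv, hh, he⟩ := h
  obtain ⟨B, hB⟩ := hh.exists_basis hirr hv hdim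
  have e0 : th (d : F) (-b) 0 = th (d : F) b d := by
    rw [th_neg_reflect hd b (Nat.zero_le _), Nat.sub_zero]
  have hev : Y.HasEigenvalue (th (d : F) b d) := by
    rw [Module.End.hasEigenvalue_iff, Module.End.eigenspace_def]
    intro hker
    have hsurj := LinearMap.injective_iff_surjective.1 (LinearMap.ker_eq_bot.1 hker)
    obtain ⟨w, hw⟩ := hsurj (B (Fin.last d))
    have := LinearMap.congr_fun (hh.coord_last_comp hd B hB) w
    have h2 := congrArg (B.coord (Fin.last d)) hw
    rw [LinearMap.sub_apply, map_sub, LinearMap.smul_apply, Module.End.one_apply, map_smul,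
      ← LinearMap.comp_apply, this, LinearMap.smul_apply, sub_self] at h2
    simp at h2
  have hnev : ¬ Y.HasEigenvalue (1 - th (d : F) b d) := by
    intro hev'
    obtain ⟨w, hw⟩ := hev'.exists_hasEigenvector
    have h2 := Module.End.aeval_apply_of_hasEigenvector
      (p := lprod (th (d : F) b) (Finset.range (d + 1))) hw
    rw [hh.aeval_right B hB, LinearMap.zero_apply, eq_comm, smul_eq_zero] at h2
    have h3 := h2.resolve_right hw.2
    rw [lprod, Polynomial.eval_prod, Finset.prod_eq_zero_iff] at h3
    obtain ⟨i, hi, h4⟩ := h3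
    refine hb i (by have := Finset.mem_range.1 hi; omega) ?_
    simp only [Polynomial.eval_sub, Polynomial.eval_X, Polynomial.eval_C] at h4
    linear_combination -h4
  obtain ⟨w, hw⟩ := hev.exists_hasEigenvector
  have e1 : cen (d : F) a (-b) c = cen (d : F) a b c := by simp only [cen]; ring
  have e2 : cen (d : F) (-b) c a = cen (d : F) b c a := by simp only [cen]; ring
  have e3 : cen (d : F) c a (-b) = cen (d : F) c a b := by simp only [cen]; ring
  have hp : IsEPair X Y (d : F) a (-b) c := by
    rw [IsEPair, e1, e2, e3]; exact hh.pair
  have hw0 : Y w = th (d : F) (-b) 0 • w := by rw [e0]; exact hw.apply_eq_smul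
  refine ⟨by rwa [e1], w, hw.2, ⟨hp, hw0, apply_apply_of_not_hasEigenvalue hp hw0 (by rwa [e0])
    hw.2⟩, ?_⟩
  have hX : Polynomial.aeval X (lprod (th (d : F) a) (Finset.range (d + 1))) = 0 := by
    have he' := he
    rw [chain_eq_aeval] at he'
    refine B.ext fun i => ?_
    rw [hB, chain_eq_aeval, ← Module.End.mul_apply, ← map_mul, mul_comm, map_mul,
      Module.End.mul_apply, he', map_zero, LinearMap.zero_apply]
  rw [chain_eq_aeval, hX, LinearMap.zero_apply]

/-- An equality θ*_i = 1 - θ*_d with i ≤ d forces i odd and 2b = -(i+1), a negative integer; this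
cannot hold for both b and -b. -/
theorem forall_th_ne_or {d : ℕ} (hd : Odd d) (b : F) :
    (∀ i ≤ d, th (d : F) b i ≠ 1 - th (d : F) b d) ∨
      ∀ i ≤ d, th (d : F) (-b) i ≠ 1 - th (d : F) (-b) d := by
  have key : ∀ x : F, ∀ i ≤ d, th (d : F) x i = 1 - th (d : F) x d → 2 * x = -(i + 1 : ℕ) := by
    intro x i hi e
    obtain ⟨n, rfl⟩ := hd
    rw [th_odd] at e
    obtain ⟨k, rfl | rfl⟩ := i.even_or_odd'
    · exfalso
      rw [th_even] at e
      have h2 : ((2 * k : ℕ) : F) = ((2 * n + 2 : ℕ) : F) := by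
        push_cast at e ⊢
        linear_combination e
      have := Nat.cast_injective h2
      omega
    · rw [th_odd] at e
      push_cast at e ⊢
      linear_combination -e
  by_contra! hcon
  obtain ⟨⟨i, hi, e⟩, j, hj, e'⟩ := hcon
  have h1 := key b i hi e
  have h2 := key (-b) j hj e'
  have : ((i + 1 + (j + 1) : ℕ) : F) = 0 := by
    push_cast at h1 h2 ⊢
    linear_combination h1 + h2
  have := Nat.cast_eq_zero.1 this
  omega

/-- For even i, φ_i is non-zero in characteristic 0. For odd i it is a difference of squares whose
factors vanish exactly when a + b ± c hits an excluded value; the sign change of a and the symmetry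
of the excluded set give the other two conditions. -/
theorem mem_EP_iff {d : ℕ} (hd : Odd d) (a b c : F) :
    (a, b, c) ∈ EP F d ↔ (∀ i, 1 ≤ i → i ≤ d → ph (d : F) a b c i ≠ 0) ∧
      ∀ i, 1 ≤ i → i ≤ d → ph (d : F) (-a) b c i ≠ 0 := by
  have key : ∀ x : F, (∀ i, 1 ≤ i → i ≤ d → ph (d : F) x b c i ≠ 0) ↔
      x + b + c ∉ excluded F d ∧ x + b - c ∉ excluded F d := by
    intro x
    constructor
    · intro h
      constructor <;>
      · rintro ⟨i, ⟨k, rfl⟩, hi, e⟩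
        have := hd.pos
        refine h (2 * k + 1) (by omega) (by omega) ?_
        rw [ph_odd]
        push_cast at e
        first
        | linear_combination (-(x + b - c) - (2 * k - ((d : F) - 1) / 2)) * e
        | linear_combination (-(x + b + c) - (2 * k - ((d : F) - 1) / 2)) * e
    · rintro ⟨h1, h2⟩ i hi hid
      obtain ⟨k, rfl | rfl⟩ := i.even_or_odd'
      · rw [ph_even]
        obtain ⟨m, rfl⟩ : ∃ m, d = 2 * k + m := ⟨d - 2 * k, by omega⟩
        have e : (2 * k : F) * (((2 * k + m : ℕ) : F) - 2 * k + 1) = ((2 * k * (m + 1) : ℕ) : F) := by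
          push_cast; ring
        rw [e, Nat.cast_ne_zero]
        have : 0 < k := by omega
        positivity
      · rw [ph_odd]
        intro e
        have e' : (x + b + c - (((d : F) - 1) / 2 - (2 * k : ℕ))) *
            (x + b - c - (((d : F) - 1) / 2 - (2 * k : ℕ))) = 0 := by
          push_cast
          linear_combination -e
        rcases mul_eq_zero.1 e' with e' | e'
        · exact h1 ⟨2 * k, by simp, by omega, sub_eq_zero.1 e'⟩
        · exact h2 ⟨2 * k, by simp, by omega, sub_eq_zero.1 e'⟩
  have hneg : a - b + c ∉ excluded F d ↔ -a + b - c ∉ excluded F d := by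
    constructor <;> intro h h' <;> apply h <;> apply neg_mem_excluded F hd <;>
      · convert h' using 1; ring
  rw [key, key, EP, Set.mem_ofPred_eq, hneg]
  tauto

end HighestWeight

/-! ### Transport along equivalences and changes of sign -/

theorem induction {F : Type u} [Field F] {p : BI F → Prop} (hF : ∀ r, p (algebraMap F (BI F) r))
    (hg : ∀ g, p (gen F g)) (hm : ∀ x y, p x → p y → p (x * y)) (ha : ∀ x y, p x → p y → p (x + y))
    (x : BI F) : p x := by
  obtain ⟨y, rfl⟩ := RingQuot.mkAlgHom_surjective F (Rel F) x
  change p (mk F y)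
  induction y with
  | grade0 r => rw [AlgHom.commutes]; exact hF r
  | grade1 g => exact hg g
  | mul a b ha' hb' => rw [map_mul]; exact hm _ _ ha' hb'
  | add a b ha' hb' => rw [map_add]; exact ha _ _ ha' hb'

section Transport

variable {F V W : Type*} [Field F] [AddCommGroup V] [Module F V] [AddCommGroup W] [Module F W]

theorem chain_map {X : Module.End F V} {X' : Module.End F W} (f : V ≃ₗ[F] W)
    (hX : ∀ v, f (X v) = X' (f v)) (t : ℕ → F) (v : V) (n : ℕ) :
    f (chain X t v n) = chain X' t (f v) n := by
  induction n with
  | zero => rfl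
  | succ n ih => rw [chain, chain, map_sub, map_smul, hX, ih]

theorem HasHighest.of_equiv {X Y Z : Module.End F V} {X' Y' Z' : Module.End F W} (f : V ≃ₗ[F] W)
    (hX : ∀ v, f (X v) = X' (f v)) (hY : ∀ v, f (Y v) = Y' (f v)) (hZ : ∀ v, f (Z v) = Z' (f v))
    {d : ℕ} {a b c : F} (h : HasHighest X Y Z d a b c) : HasHighest X' Y' Z' d a b c := by
  obtain ⟨h1, v, hv, hh, he⟩ := h
  refine ⟨fun w => ?_, f v, by simpa using hv, ⟨⟨fun w => ?_, fun w => ?_⟩, ?_, ?_⟩, ?_⟩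
  · obtain ⟨w, rfl⟩ := f.surjective w
    rw [← hZ, h1]
    simp only [map_add, map_sub, map_smul, hX, hY]
  · obtain ⟨w, rfl⟩ := f.surjective w
    have := congrArg f (hh.pair.left w)
    simpa only [map_add, map_smul, hX, hY] using this
  · obtain ⟨w, rfl⟩ := f.surjective w
    have := congrArg f (hh.pair.right w)
    simpa only [map_add, map_smul, hX, hY] using this
  · rw [← hY, hh.weight, map_smul]
  · rw [← hX, ← hY, hh.next, map_add, map_smul, map_smul]
  · rw [← chain_map f hX, he, map_zero]

theorem IsIrred.of_equiv {X Y : Module.End F V} {X' Y' : Module.End F W} (f : V ≃ₗ[F] W)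
    (hX : ∀ v, f (X v) = X' (f v)) (hY : ∀ v, f (Y v) = Y' (f v)) (h : IsIrred X Y) :
    IsIrred X' Y' := by
  have := h.1
  refine ⟨f.symm.toEquiv.nontrivial, fun U hXU hYU => ?_⟩
  have hc := h.2 (U.comap f.toLinearMap) (fun w hw => ?_) (fun w hw => ?_)
  · rcases hc with hc | hc
    · left
      rw [← Submodule.map_comap_eq_of_surjective (f := f.toLinearMap) f.surjective U, hc,
        Submodule.map_bot]
    · right
      rw [← Submodule.map_comap_eq_of_surjective (f := f.toLinearMap) f.surjective U, hc,
        Submodule.map_top]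
      exact LinearMap.range_eq_top.2 f.surjective
  · simp only [Submodule.mem_comap, LinearEquiv.coe_coe, hX] at hw ⊢
    exact hXU _ hw
  · simp only [Submodule.mem_comap, LinearEquiv.coe_coe, hY] at hw ⊢
    exact hYU _ hw

/-- The prescribed trace is non-zero, so T and -T cannot both have it. -/
theorem sign_eq_of_trace [CharZero F] {d : ℕ} {T : Module.End F V} {s t : ℤˣ}
    (hs : LinearMap.trace F V (((s : ℤ) : F) • T) = -((d : F) + 1) / 2)
    (ht : LinearMap.trace F V (((t : ℤ) : F) • T) = -((d : F) + 1) / 2) : s = t := by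
  have hne : (-((d : F) + 1) / 2) ≠ 0 :=
    div_ne_zero (neg_ne_zero.2 (by exact_mod_cast d.succ_ne_zero)) two_ne_zero
  rw [map_smul, smul_eq_mul] at hs ht
  rcases Int.units_eq_one_or s with rfl | rfl <;> rcases Int.units_eq_one_or t with rfl | rfl
  · rfl
  · exfalso
    apply hne
    simp only [Units.val_neg, Units.val_one, Int.cast_neg, Int.cast_one] at hs ht
    linear_combination -(hs + ht) / 2
  · exfalso
    apply hne
    simp only [Units.val_neg, Units.val_one, Int.cast_neg, Int.cast_one] at hs ht
    linear_combination -(hs + ht) / 2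
  · rfl

theorem IsPair.smul {X Y : Module.End F V} {κ l m : F} (h : IsPair X Y κ l m) {s t : F}
    (hs : s * s = 1) (ht : t * t = 1) : IsPair (s • X) (t • Y) (s * t * κ) (s * l) (t * m) where
  left v := by
    have h1 := h.left v
    simp only [LinearMap.smul_apply, map_smul, smul_smul] at h1 ⊢
    rw [show s * t * t = s by rw [mul_assoc, ht, mul_one], show t * t * s = s by rw [ht, one_mul],
      show 2 * (t * s * t) = s * 2 by linear_combination (2 * s) * ht,
      show 2 * (s * t * κ) * t = s * (2 * κ) by linear_combination (2 * s * κ) * ht]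
    linear_combination (norm := module) s • h1
  right v := by
    have h1 := h.right v
    simp only [LinearMap.smul_apply, map_smul, smul_smul] at h1 ⊢
    rw [show t * s * s = t by rw [mul_assoc, hs, mul_one], show s * s * t = t by rw [hs, one_mul],
      show 2 * (s * t * s) = t * 2 by linear_combination (2 * t) * hs,
      show 2 * (s * t * κ) * s = t * (2 * κ) by linear_combination (2 * t * κ) * hs]
    linear_combination (norm := module) t • h1

/-- If it is -1 - θ that is missing from the spectrum of Y, then 1 - (-θ) is missing from that of
-Y. -/
theorem exists_sign_hasEigenvalue [IsAlgClosed F] [CharZero F] [FiniteDimensional F V]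
    [Nontrivial V] (Y : Module.End F V) : ∃ (s : ℤˣ) (θ : F),
      (((s : ℤ) : F) • Y).HasEigenvalue θ ∧ ¬ (((s : ℤ) : F) • Y).HasEigenvalue (1 - θ) := by
  obtain ⟨θ, h, h' | h'⟩ := exists_hasEigenvalue_not_hasEigenvalue Y
  · exact ⟨1, θ, by simpa using h, by simpa using h'⟩
  · refine ⟨-1, -θ, ?_, fun h2 => h' ?_⟩
    · obtain ⟨v, hv⟩ := h.exists_hasEigenvector
      refine Module.End.hasEigenvalue_of_hasEigenvector (x := v) (Module.End.hasEigenvector_iff.2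
        ⟨Module.End.mem_eigenspace_iff.2 ?_, hv.2⟩)
      simp [hv.apply_eq_smul]
    · obtain ⟨v, hv⟩ := h2.exists_hasEigenvector
      refine Module.End.hasEigenvalue_of_hasEigenvector (x := v) (Module.End.hasEigenvector_iff.2
        ⟨Module.End.mem_eigenspace_iff.2 ?_, hv.2⟩)
      have := hv.apply_eq_smul
      simp only [Units.val_neg, Units.val_one, Int.cast_neg, Int.cast_one, neg_smul, one_smul,
        LinearMap.neg_apply, sub_neg_eq_add] at this
      rw [neg_eq_iff_eq_neg] at this
      rw [this]
      module

end Transport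

/-! ### Modules over the algebra as pairs of operators -/

section Modules

variable {F : Type u} [Field F] {V W : Type*} [AddCommGroup V] [Module F V] [Module (BI F) V]
  [IsScalarTower F (BI F) V] [AddCommGroup W] [Module F W] [Module (BI F) W]
  [IsScalarTower F (BI F) W]

/-- The action of a generator, multiplied by the sign by which `(ε, ε')` acts on it. -/
def op (F : Type u) [Field F] (V : Type*) [AddCommGroup V] [Module F V] [Module (BI F) V]
    [IsScalarTower F (BI F) V] (ε ε' : ℤˣ) (g : BIGen) : Module.End F V :=
  (((genSign ε ε' g : ℤˣ) : ℤ) : F) • Algebra.lsmul F F V (gen F g)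

theorem op_apply (ε ε' : ℤˣ) (g : BIGen) (v : V) :
    op F V ε ε' g v = (((genSign ε ε' g : ℤˣ) : ℤ) : F) • gen F g • v := rfl

theorem sign_mul_self (s : ℤˣ) : ((s : ℤ) : F) * ((s : ℤ) : F) = 1 := by
  rcases Int.units_eq_one_or s with rfl | rfl <;> simp

theorem gen_smul (ε ε' : ℤˣ) (g : BIGen) (v : V) :
    gen F g • v = (((genSign ε ε' g : ℤˣ) : ℤ) : F) • op F V ε ε' g v := by
  rw [op_apply, smul_smul, sign_mul_self, one_smul]

theorem smul_mem_of_gen {U : Submodule F V} (hU : ∀ g, ∀ v ∈ U, gen F g • v ∈ U) (x : BI F) :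
    ∀ v ∈ U, x • v ∈ U := by
  induction x using BI.induction with
  | hF r => intro v hv; rw [algebraMap_smul]; exact U.smul_mem _ hv
  | hg g => exact hU g
  | hm x y hx hy => intro v hv; rw [mul_smul]; exact hx _ (hy v hv)
  | ha x y hx hy => intro v hv; rw [add_smul]; exact U.add_mem (hx v hv) (hy v hv)

/-- An `F`-linear equivalence that commutes with the generators is an isomorphism. -/
def equivOfGen (f : V ≃ₗ[F] W) (hf : ∀ g v, f (gen F g • v) = gen F g • f v) : V ≃ₗ[BI F] W :=
  have key : ∀ (x : BI F) v, f (x • v) = x • f v := fun x => by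
    induction x using BI.induction with
    | hF r => intro v; rw [algebraMap_smul, algebraMap_smul, map_smul]
    | hg g => exact hf g
    | hm x y hx hy => intro v; rw [mul_smul, mul_smul, hx, hy]
    | ha x y hx hy => intro v; rw [add_smul, add_smul, map_add, hx, hy]
  { f with map_smul' := key }

theorem gen_smul_mem {ε ε' : ℤˣ} {κ : F}
    (hZ : ∀ v, op F V ε ε' .Z v =
      op F V ε ε' .X (op F V ε ε' .Y v) + op F V ε ε' .Y (op F V ε ε' .X v) - κ • v)
    {U : Submodule F V} (hX : ∀ v ∈ U, op F V ε ε' .X v ∈ U) (hY : ∀ v ∈ U, op F V ε ε' .Y v ∈ U)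
    (g : BIGen) : ∀ v ∈ U, gen F g • v ∈ U := by
  intro v hv
  rw [gen_smul ε ε']
  refine U.smul_mem _ ?_
  match g with
  | .X => exact hX v hv
  | .Y => exact hY v hv
  | .Z =>
    rw [hZ]
    exact U.sub_mem (U.add_mem (hX _ (hY v hv)) (hY _ (hX v hv))) (U.smul_mem _ hv)

theorem isIrred_of_isSimpleModule [IsSimpleModule (BI F) V] {ε ε' : ℤˣ} {κ : F}
    (hZ : ∀ v, op F V ε ε' .Z v =
      op F V ε ε' .X (op F V ε ε' .Y v) + op F V ε ε' .Y (op F V ε ε' .X v) - κ • v) :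
    IsIrred (op F V ε ε' .X) (op F V ε ε' .Y) := by
  refine ⟨IsSimpleModule.nontrivial (BI F) V, fun U hX hY => ?_⟩
  have hU := smul_mem_of_gen (gen_smul_mem hZ hX hY)
  let U' : Submodule (BI F) V := { U with smul_mem' := fun x v hv => hU x v hv }
  rcases eq_bot_or_eq_top U' with h | h
  · left
    ext v
    exact (SetLike.ext_iff.1 h v)
  · right
    ext v
    exact (SetLike.ext_iff.1 h v)

theorem isSimpleModule_of_isIrred {ε ε' : ℤˣ} (h : IsIrred (op F V ε ε' .X) (op F V ε ε' .Y)) :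
    IsSimpleModule (BI F) V := by
  have := h.1
  rw [isSimpleModule_iff]
  refine { eq_bot_or_eq_top := fun U => ?_ }
  have hop : ∀ g, ∀ w ∈ U.restrictScalars F, op F V ε ε' g w ∈ U.restrictScalars F := fun g w hw =>
    (U.restrictScalars F).smul_mem _ (U.smul_mem _ hw)
  simpa using h.2 (U.restrictScalars F) (hop _) (hop _)

/-- Substitute Z = XY + YX - κ in the relations for λ and μ. -/
theorem isPair_of_scalar {κ l m : F}
    (hκ : ∀ v : V, (anti (gen F .X) (gen F .Y) - gen F .Z) • v = κ • v)
    (hl : ∀ v : V, (anti (gen F .Y) (gen F .Z) - gen F .X) • v = l • v)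
    (hm : ∀ v : V, (anti (gen F .Z) (gen F .X) - gen F .Y) • v = m • v) :
    IsPair (op F V 1 1 .X) (op F V 1 1 .Y) κ l m ∧ ∀ v, op F V 1 1 .Z v =
      op F V 1 1 .X (op F V 1 1 .Y v) + op F V 1 1 .Y (op F V 1 1 .X v) - κ • v := by
  have e : ∀ g (v : V), gen F g • v = op F V 1 1 g v := fun g v => by
    rw [gen_smul 1 1]; cases g <;> simp [genSign]
  simp only [anti, sub_smul, add_smul, mul_smul, e] at hκ hl hm
  have hZ : ∀ v, op F V 1 1 .Z v =
      op F V 1 1 .X (op F V 1 1 .Y v) + op F V 1 1 .Y (op F V 1 1 .X v) - κ • v := fun v => by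
    rw [← hκ v]; abel
  refine ⟨⟨fun v => ?_, fun v => ?_⟩, hZ⟩
  · have := hl v
    simp only [hZ, map_add, map_sub, map_smul] at this
    linear_combination (norm := module) this
  · have := hm v
    simp only [hZ, map_add, map_sub, map_smul] at this
    linear_combination (norm := module) this

theorem isPair_op {κ l m : F} (h : IsPair (op F V 1 1 .X) (op F V 1 1 .Y) κ l m)
    (hZ : ∀ v, op F V 1 1 .Z v =
      op F V 1 1 .X (op F V 1 1 .Y v) + op F V 1 1 .Y (op F V 1 1 .X v) - κ • v) (ε ε' : ℤˣ) :
    ∃ κ' l' m', IsPair (op F V ε ε' .X) (op F V ε ε' .Y) κ' l' m' ∧ ∀ v, op F V ε ε' .Z v =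
      op F V ε ε' .X (op F V ε ε' .Y v) + op F V ε ε' .Y (op F V ε ε' .X v) - κ' • v := by
  have e : ∀ g, op F V ε ε' g = (((genSign ε ε' g : ℤˣ) : ℤ) : F) • op F V 1 1 g := fun g => by
    ext v
    simp only [op_apply, LinearMap.smul_apply]
    cases g <;> simp [genSign]
  refine ⟨_, _, _, by
    rw [e, e]
    exact h.smul (sign_mul_self _) (sign_mul_self _), fun v => ?_⟩
  rw [e, e, e]
  simp only [LinearMap.smul_apply, hZ, map_smul, genSign]
  push_cast
  module

/-- Schur's lemma: an eigenspace of a central element is a submodule. -/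
theorem exists_smul_eq_of_commute [IsAlgClosed F] [FiniteDimensional F V] [IsSimpleModule (BI F) V]
    {z : BI F} (hz : ∀ g, Commute z (gen F g)) : ∃ k : F, ∀ v : V, z • v = k • v := by
  have := IsSimpleModule.nontrivial (BI F) V
  obtain ⟨k, hk⟩ := Module.End.exists_eigenvalue (Algebra.lsmul F F V z : Module.End F V)
  have hU : ∀ x : BI F, ∀ v ∈ Module.End.eigenspace (Algebra.lsmul F F V z : Module.End F V) k,
      x • v ∈ Module.End.eigenspace (Algebra.lsmul F F V z : Module.End F V) k := by
    refine smul_mem_of_gen fun g v hv => ?_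
    rw [Module.End.mem_eigenspace_iff] at hv ⊢
    change z • v = k • v at hv
    change z • gen F g • v = k • gen F g • v
    rw [← mul_smul, (hz g).eq, mul_smul, hv, smul_comm]
  let U' : Submodule (BI F) V :=
    { Module.End.eigenspace (Algebra.lsmul F F V z : Module.End F V) k with
      smul_mem' := fun x v hv => hU x v hv }
  obtain ⟨v, hv⟩ := hk.exists_hasEigenvector
  have htop : U' = ⊤ := by
    refine (eq_bot_or_eq_top U').resolve_left fun h => hv.2 ?_
    have : v ∈ U' := hv.1
    rw [h] at this
    simpa using this
  refine ⟨k, fun w => ?_⟩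
  have : w ∈ U' := by rw [htop]; trivial
  exact Module.End.mem_eigenspace_iff.1 this

/-- Every simple module of dimension `d + 1` has a highest weight vector, up to signs. -/
theorem exists_hasHighest [IsAlgClosed F] [CharZero F] [FiniteDimensional F V]
    [IsSimpleModule (BI F) V] {d : ℕ} (hd : Odd d) (hdim : Module.finrank F V = d + 1) :
    ∃ (ε ε' : ℤˣ) (a b c : F), HasHighest (op F V ε ε' .X) (op F V ε ε' .Y) (op F V ε ε' .Z) d a b c := by
  have := IsSimpleModule.nontrivial (BI F) V
  obtain ⟨κ, hκ⟩ := exists_smul_eq_of_commute (V := V) (commute_kappa F)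
  obtain ⟨l, hl⟩ := exists_smul_eq_of_commute (V := V) (commute_lambda F)
  obtain ⟨m, hm⟩ := exists_smul_eq_of_commute (V := V) (commute_mu F)
  obtain ⟨hp, hZ⟩ := isPair_of_scalar hκ hl hm
  obtain ⟨ε, η, hη, hη'⟩ := exists_sign_hasEigenvalue (Algebra.lsmul F F V (gen F .X) : Module.End F V)
  obtain ⟨ε', θ, hθ, hθ'⟩ := exists_sign_hasEigenvalue (Algebra.lsmul F F V (gen F .Y) : Module.End F V)
  obtain ⟨κ', l', m', hp', hZ'⟩ := isPair_op hp hZ ε ε'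
  obtain ⟨a, b, c, v, hv, e, hh, he⟩ := hp'.exists_isHighest (isIrred_of_isSimpleModule hZ') hd hdim
    (θ := θ) (η := η) hθ hθ' hη hη'
  exact ⟨ε, ε', a, b, c, by rwa [← e], v, hv, hh, he⟩

theorem HasHighest.isIrred [IsSimpleModule (BI F) V] {d : ℕ} {ε ε' : ℤˣ} {a b c : F}
    (h : HasHighest (op F V ε ε' .X) (op F V ε ε' .Y) (op F V ε ε' .Z) d a b c) :
    IsIrred (op F V ε ε' .X) (op F V ε ε' .Y) :=
  isIrred_of_isSimpleModule h.1

end Modules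

/-! ### Basis vectors of E_d(a,b,c) -/

section Indicator

variable {F : Type u} [Field F]

/-- The indicator function of `n`. -/
def ind (F : Type u) [Field F] (n : ℕ) : ℕ → F := fun k => if k = n then 1 else 0

theorem seqY_ind_one (d : ℕ) (a b c : F) :
    seqY d a b c (ind F 1) = th (d : F) b 1 • ind F 1 + ph (d : F) a b c 1 • ind F 0 := by
  funext k
  match k with
  | 0 => simp [seqY, ind, ph, phi]
  | 1 => simp [seqY, ind, th, theta]
  | k + 2 => simp [seqY, ind]

theorem res_ind_last (d : ℕ) : res d (ind F (d + 1)) = 0 := by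
  funext i
  have := i.2
  simp [res, ind, this.ne]

theorem res_ind (d : ℕ) (i : Fin (d + 1)) : res d (ind F i) = Pi.single i 1 := by
  funext j
  simp [res, ind, Pi.single_apply, Fin.ext_iff]

theorem exists_units_smul_eq {x y : F} (h : x ^ 2 = y ^ 2) : ∃ s : ℤˣ, s • y = x := by
  rcases sq_eq_sq_iff_eq_or_eq_neg.1 h with h | h
  · exact ⟨1, by rw [one_smul, h]⟩
  · exact ⟨-1, by rw [Units.neg_smul, one_smul, h]⟩

end Indicator

/-! ### The modules E_d(a,b,c), their twists, and the bijection -/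

section EModules

open scoped ModuleCat

variable {F : Type u} [Field F]

/-- The space underlying a twisted module. -/
def equivTwist (ε ε' : ℤˣ) (V : ModuleCat.{u} (BI F)) : V ≃ₗ[F] twist ε ε' V where
  toFun w := w
  invFun w := w
  map_add' _ _ := rfl
  map_smul' r w := by
    change algebraMap F (BI F) r • w = signAut F ε ε' (algebraMap F (BI F) r) • w
    rw [AlgEquiv.commutes]
  left_inv _ := rfl
  right_inv _ := rfl

/-- The signs in `op` undo those of the twist, so the twisted module with signs (ε, ε') carries the
same operators as V. -/
theorem op_equivTwist (ε ε' : ℤˣ) (V : ModuleCat.{u} (BI F)) (g : BIGen) (v : V) :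
    equivTwist ε ε' V (op F V 1 1 g v) = op F (twist ε ε' V) ε ε' g (equivTwist ε ε' V v) := by
  have h : gen F g • equivTwist ε ε' V v =
      equivTwist ε ε' V (signHom F ε ε' (gen F g) • v) := rfl
  have h1 : op F V 1 1 g v = gen F g • v := by
    rw [op_apply]; cases g <;> simp [genSign]
  rw [h1, op_apply, h, signHom_gen, ← map_smul, ← Int.cast_smul_eq_zsmul F, smul_assoc, smul_smul,
    sign_mul_self, one_smul]

variable [CharZero F]

theorem E_smul (d : ℕ) (hd : Odd d) (a b c : F) (x : BI F) (w : Fin (d + 1) → F) :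
    (x • (show E d hd a b c from w) : E d hd a b c) = (repE d hd a b c x).mulVec w := rfl

/-- The space of column vectors, as the space underlying `E_d(a,b,c)`. -/
def equivE (d : ℕ) (hd : Odd d) (a b c : F) : (Fin (d + 1) → F) ≃ₗ[F] E d hd a b c where
  toFun w := w
  invFun w := w
  map_add' _ _ := rfl
  map_smul' r w := by
    have h : (algebraMap F (BI F) r • (show E d hd a b c from w) : E d hd a b c) =
        (r • w : Fin (d + 1) → F) := by
      rw [E_smul, AlgHom.commutes, Algebra.algebraMap_eq_smul_one, Matrix.smul_mulVec, Matrix.one_mulVec]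
    exact h.symm
  left_inv _ := rfl
  right_inv _ := rfl

theorem smul_equivE (d : ℕ) (hd : Odd d) (a b c : F) (x : BI F) (w : Fin (d + 1) → F) :
    x • equivE d hd a b c w = equivE d hd a b c ((repE d hd a b c x).mulVec w) := rfl

theorem repE_gen (d : ℕ) (hd : Odd d) (a b c : F) (g : BIGen) :
    repE d hd a b c (gen F g) = matE d a b c g :=
  lift_gen _ _ _ _ g

theorem op_equivE (d : ℕ) (hd : Odd d) (a b c : F) (g : BIGen) (w : Fin (d + 1) → F) :
    op F (E d hd a b c) 1 1 g (equivE d hd a b c w) =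
      equivE d hd a b c ((matE d a b c g).mulVec w) := by
  rw [op_apply, smul_equivE, repE_gen]
  cases g <;> simp [genSign]

theorem seqX_ind (d : ℕ) (a : F) (n : ℕ) :
    seqX d a (ind F n) = ind F (n + 1) + th (d : F) a n • ind F n := by
  funext k
  simp only [seqX, ind, Pi.add_apply, Pi.smul_apply, smul_eq_mul]
  cases k with
  | zero =>
    by_cases h : 0 = n
    · subst h; simp [th, theta]
    · simp [h]
  | succ k =>
    by_cases h : k + 1 = n
    · subst h; simp [th, theta]
    · by_cases h' : k = n
      · subst h'; simp
      · simp [h, h']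

theorem seqY_ind_zero (d : ℕ) (a b c : F) : seqY d a b c (ind F 0) = th (d : F) b 0 • ind F 0 := by
  funext k
  cases k <;> simp [seqY, ind, th, theta]

theorem chain_E (d : ℕ) (hd : Odd d) (a b c : F) (n : ℕ) :
    chain (op F (E d hd a b c) 1 1 .X) (th (d : F) a) (equivE d hd a b c (res d (ind F 0))) n =
      equivE d hd a b c (res d (ind F n)) := by
  induction n with
  | zero => rfl
  | succ n ih =>
    rw [chain, ih, op_equivE, matE, matX_res, seqX_ind, ← map_smul, res_smul, ← map_sub, res_sub,
      add_sub_cancel_right]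

theorem isHighest_E (d : ℕ) (hd : Odd d) (a b c : F) :
    IsHighest (op F (E d hd a b c) 1 1 .X) (op F (E d hd a b c) 1 1 .Y) (d : F) a b c
        (equivE d hd a b c (res d (ind F 0))) ∧
      ∀ v, op F (E d hd a b c) 1 1 .Z v = op F (E d hd a b c) 1 1 .X (op F _ 1 1 .Y v) +
        op F (E d hd a b c) 1 1 .Y (op F _ 1 1 .X v) - cen (d : F) a b c • v := by
  have hs : ∀ (x : BI F) (r : F), repE d hd a b c x = Matrix.scalar _ r →
      ∀ v : E d hd a b c, x • v = r • v := by
    intro x r h v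
    obtain ⟨w, rfl⟩ := (equivE d hd a b c).surjective v
    rw [smul_equivE, h, scalar_mulVec, map_smul]
  obtain ⟨hp, hZ⟩ := isPair_of_scalar (V := E d hd a b c) (κ := cen (d : F) a b c)
    (l := cen (d : F) b c a) (m := cen (d : F) c a b)
    (hs _ _ (by
      rw [map_sub, anti, map_add, map_mul, map_mul, repE_gen, repE_gen, repE_gen]
      exact matE_kappa d a b c))
    (hs _ _ (by
      rw [map_sub, anti, map_add, map_mul, map_mul, repE_gen, repE_gen, repE_gen]
      refine (matE_lambda d hd a b c).trans ?_
      congr 1))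
    (hs _ _ (by
      rw [map_sub, anti, map_add, map_mul, map_mul, repE_gen, repE_gen, repE_gen]
      refine (matE_mu d hd a b c).trans ?_
      congr 1))
  refine ⟨⟨hp, ?_, ?_⟩, hZ⟩
  · rw [op_equivE, matE, matY_res d hd, seqY_ind_zero, ← res_smul, map_smul]
  · have h1 : op F (E d hd a b c) 1 1 .X (equivE d hd a b c (res d (ind F 0))) =
        equivE d hd a b c (res d (ind F 1)) +
          th (d : F) a 0 • equivE d hd a b c (res d (ind F 0)) := by
      rw [op_equivE, matE, matX_res, seqX_ind, ← res_add, ← res_smul, map_add, map_smul]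
    have h0 : op F (E d hd a b c) 1 1 .Y (equivE d hd a b c (res d (ind F 0))) =
        th (d : F) b 0 • equivE d hd a b c (res d (ind F 0)) := by
      rw [op_equivE, matE, matY_res d hd, seqY_ind_zero, ← res_smul, map_smul]
    have h2 : op F (E d hd a b c) 1 1 .Y (equivE d hd a b c (res d (ind F 1))) =
        th (d : F) b 1 • equivE d hd a b c (res d (ind F 1)) +
          ph (d : F) a b c 1 • equivE d hd a b c (res d (ind F 0)) := by
      rw [op_equivE, matE, matY_res d hd, seqY_ind_one, ← res_add, ← res_smul, ← res_smul, map_add,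
        map_smul, map_smul]
    have e : nu (d : F) a b c = ph (d : F) a b c 1 + th (d : F) a 0 * (th (d : F) b 0 - th (d : F) b 1) := by
      simp [ph, nu, th]; field_simp; ring
    rw [h1, map_add, map_smul, h0, h2, e]
    module

theorem hasHighest_E (d : ℕ) (hd : Odd d) (a b c : F) :
    HasHighest (op F (E d hd a b c) 1 1 .X) (op F (E d hd a b c) 1 1 .Y)
      (op F (E d hd a b c) 1 1 .Z) d a b c := by
  obtain ⟨h, hZ⟩ := isHighest_E d hd a b c
  refine ⟨hZ, _, ?_, h, ?_⟩
  · intro e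
    have h0 := congrFun ((equivE d hd a b c).map_eq_zero_iff.1 e) 0
    simp [res, ind] at h0
  · rw [chain_E, res_ind_last, map_zero]

theorem isIrred_E {d : ℕ} (hd : Odd d) {a b c : F} (h : (a, b, c) ∈ EP F d) :
    IsIrred (op F (E d hd a b c) 1 1 .X) (op F (E d hd a b c) 1 1 .Y) := by
  refine ⟨(equivE d hd a b c).symm.toEquiv.nontrivial, fun W hX hY => or_iff_not_imp_left.2 fun hW => ?_⟩
  obtain ⟨h1, h2⟩ := (mem_EP_iff hd a b c).1 h
  refine eq_top_of_invariant hd (isHighest_E d hd a b c).1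
    (Module.Basis.ofEquivFun (equivE d hd a b c).symm) (fun i => ?_) ?_ h1 h2 hX hY hW
  · rw [chain_E, res_ind, Module.Basis.coe_ofEquivFun, LinearEquiv.symm_symm]
  · rw [chain_E, res_ind_last, map_zero]

theorem finrank_twist_E (ε ε' : ℤˣ) (d : ℕ) (hd : Odd d) (a b c : F) :
    Module.finrank F (twist ε ε' (E d hd a b c)) = d + 1 := by
  rw [← ((equivE d hd a b c).trans (equivTwist ε ε' _)).finrank_eq]
  simp

theorem hasHighest_twist_E (ε ε' : ℤˣ) (d : ℕ) (hd : Odd d) (a b c : F) :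
    HasHighest (op F (twist ε ε' (E d hd a b c)) ε ε' .X) (op F (twist ε ε' (E d hd a b c)) ε ε' .Y)
      (op F (twist ε ε' (E d hd a b c)) ε ε' .Z) d a b c :=
  (hasHighest_E d hd a b c).of_equiv (equivTwist ε ε' _) (op_equivTwist ε ε' _ _)
    (op_equivTwist ε ε' _ _) (op_equivTwist ε ε' _ _)

theorem isSimpleModule_twist_E (ε ε' : ℤˣ) {d : ℕ} (hd : Odd d) {a b c : F}
    (h : (a, b, c) ∈ EP F d) : IsSimpleModule (BI F) (twist ε ε' (E d hd a b c)) :=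
  isSimpleModule_of_isIrred ((isIrred_E hd h).of_equiv (equivTwist ε ε' _) (op_equivTwist ε ε' _ _)
    (op_equivTwist ε ε' _ _))

theorem isoClass_eq {V W : ModuleCat.{u} (BI F)} [IsSimpleModule (BI F) V] [IsSimpleModule (BI F) W]
    {d : ℕ} (hV : Module.finrank F V = d + 1) (hW : Module.finrank F W = d + 1) {ε ε' : ℤˣ} {a b c : F}
    (h : HasHighest (op F V ε ε' .X) (op F V ε ε' .Y) (op F V ε ε' .Z) d a b c)
    (h' : HasHighest (op F W ε ε' .X) (op F W ε ε' .Y) (op F W ε ε' .Z) d a b c) :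
    isoClass V = isoClass W := by
  have : FiniteDimensional F V := FiniteDimensional.of_finrank_pos (by omega)
  have : FiniteDimensional F W := FiniteDimensional.of_finrank_pos (by omega)
  obtain ⟨f, hf⟩ := h.exists_equiv h.isIrred hV h' h'.isIrred hW
  refine Quotient.sound ⟨(equivOfGen f fun g v => ?_).toModuleIso⟩
  rw [gen_smul ε ε', gen_smul ε ε' g (f v), map_smul]
  congr 1
  match g with
  | .X => exact (hf v).1
  | .Y => exact (hf v).2.1
  | .Z => exact (hf v).2.2

theorem isoClass_twist_E_eq {ε ε' : ℤˣ} {d : ℕ} (hd : Odd d) {a b c a' b' c' : F}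
    (h : (a, b, c) ∈ EP F d) (h' : (a', b', c') ∈ EP F d)
    (hh : HasHighest (op F (twist ε ε' (E d hd a b c)) ε ε' .X)
      (op F (twist ε ε' (E d hd a b c)) ε ε' .Y)
      (op F (twist ε ε' (E d hd a b c)) ε ε' .Z) d a' b' c') :
    isoClass (twist ε ε' (E d hd a b c)) = isoClass (twist ε ε' (E d hd a' b' c')) :=
  have := isSimpleModule_twist_E ε ε' hd h
  have := isSimpleModule_twist_E ε ε' hd h'
  isoClass_eq (finrank_twist_E _ _ _ _ _ _ _) (finrank_twist_E _ _ _ _ _ _ _) hh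
    (hasHighest_twist_E ε ε' d hd a' b' c')

/-- `neg_middle` may fail for b but then applies to -b, and the conclusion is symmetric. -/
theorem isoClass_twist_E_neg_middle (ε ε' : ℤˣ) {d : ℕ} (hd : Odd d) {a b c : F}
    (h : (a, b, c) ∈ EP F d) (h' : (a, -b, c) ∈ EP F d) :
    isoClass (twist ε ε' (E d hd a b c)) = isoClass (twist ε ε' (E d hd a (-b) c)) := by
  have key : ∀ b : F, (a, b, c) ∈ EP F d → (a, -b, c) ∈ EP F d →
      (∀ i ≤ d, th (d : F) b i ≠ 1 - th (d : F) b d) →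
      isoClass (twist ε ε' (E d hd a b c)) = isoClass (twist ε ε' (E d hd a (-b) c)) := by
    intro b h h' hb
    have := isSimpleModule_twist_E ε ε' hd h
    have hdim := finrank_twist_E ε ε' d hd a b c
    have : FiniteDimensional F (twist ε ε' (E d hd a b c)) :=
      FiniteDimensional.of_finrank_pos (by omega)
    have hh := hasHighest_twist_E ε ε' d hd a b c
    exact isoClass_twist_E_eq hd h h' (hh.neg_middle hd hh.isIrred hdim hb)
  rcases forall_th_ne_or hd b with hb | hb
  · exact key b h h' hb
  · have := key (-b) h' (by rwa [neg_neg]) hb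
    rw [neg_neg] at this
    exact this.symm

theorem isoClass_twist_E_smul (ε ε' : ℤˣ) {d : ℕ} (hd : Odd d) (s : ℤˣ × ℤˣ × ℤˣ) {a b c : F}
    (h : (a, b, c) ∈ EP F d) :
    isoClass (twist ε ε' (E d hd (s.1 • a) (s.2.1 • b) (s.2.2 • c))) =
      isoClass (twist ε ε' (E d hd a b c)) := by
  obtain ⟨s, t, r⟩ := s
  have h1 : (s • a, b, c) ∈ EP F d := by simpa using smul_mem_EP F hd (s, 1, 1) h
  have h2 : (s • a, t • b, c) ∈ EP F d := by simpa using smul_mem_EP F hd (1, t, 1) h1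
  have h3 : (s • a, t • b, r • c) ∈ EP F d := by simpa using smul_mem_EP F hd (1, 1, r) h2
  have e1 : isoClass (twist ε ε' (E d hd a b c)) = isoClass (twist ε ε' (E d hd (s • a) b c)) := by
    rcases Int.units_eq_one_or s with rfl | rfl
    · rw [one_smul]
    · rw [Units.neg_smul, one_smul] at h1 ⊢
      exact isoClass_twist_E_eq hd h h1 ((hasHighest_twist_E ε ε' d hd a b c).neg_left hd)
  have e2 : isoClass (twist ε ε' (E d hd (s • a) b c)) =
      isoClass (twist ε ε' (E d hd (s • a) (t • b) c)) := by
    rcases Int.units_eq_one_or t with rfl | rfl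
    · rw [one_smul]
    · rw [Units.neg_smul, one_smul] at h2 ⊢
      exact isoClass_twist_E_neg_middle ε ε' hd h1 h2
  have e3 : isoClass (twist ε ε' (E d hd (s • a) (t • b) c)) =
      isoClass (twist ε ε' (E d hd (s • a) (t • b) (r • c))) := by
    rcases Int.units_eq_one_or r with rfl | rfl
    · rw [one_smul]
    · rw [Units.neg_smul (u := 1), one_smul] at h3 ⊢
      exact isoClass_twist_E_eq hd h2 h3 (hasHighest_twist_E ε ε' d hd _ _ c).neg_right
  exact (e1.trans (e2.trans e3)).symm

/-- Both highest weight structures are placed on one space: traces give the signs, central scalars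
the squares of the parameters. -/
theorem eq_of_isoClass_twist_E_eq {ε ε' η η' : ℤˣ} {d : ℕ} (hd : Odd d) {a b c a' b' c' : F}
    (h : (a, b, c) ∈ EP F d)
    (e : isoClass (twist ε ε' (E d hd a b c)) = isoClass (twist η η' (E d hd a' b' c'))) :
    ε = η ∧ ε' = η' ∧ ∃ s : ℤˣ × ℤˣ × ℤˣ, s.1 • a' = a ∧ s.2.1 • b' = b ∧ s.2.2 • c' = c := by
  obtain ⟨i⟩ := Quotient.exact e
  let f : twist η η' (E d hd a' b' c') ≃ₗ[BI F] twist ε ε' (E d hd a b c) := i.symm.toLinearEquiv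
  have hf : ∀ g v, f.restrictScalars F (op F (twist η η' (E d hd a' b' c')) η η' g v) =
      op F (twist ε ε' (E d hd a b c)) η η' g (f.restrictScalars F v) := by
    intro g v
    rw [op_apply, op_apply, map_smul]
    congr 1
    exact f.map_smul _ _
  have := isSimpleModule_twist_E ε ε' hd h
  have hdim := finrank_twist_E ε ε' d hd a b c
  have : FiniteDimensional F (twist ε ε' (E d hd a b c)) :=
    FiniteDimensional.of_finrank_pos (by omega)
  have h1 := hasHighest_twist_E ε ε' d hd a b c
  have h2 := (hasHighest_twist_E η η' d hd a' b' c').of_equiv (f.restrictScalars F) (hf _) (hf _) (hf _)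
  have t1 := h1.trace hd h1.isIrred hdim
  have t2 := h2.trace hd h2.isIrred hdim
  obtain rfl : ε = η := sign_eq_of_trace t1.1 t2.1
  obtain rfl : ε' = η' := sign_eq_of_trace t1.2 t2.2
  obtain ⟨q1, q2, q3⟩ := h1.sq_eq h2
  obtain ⟨s, hs⟩ := exists_units_smul_eq q1
  obtain ⟨t, ht⟩ := exists_units_smul_eq q2
  obtain ⟨r, hr⟩ := exists_units_smul_eq q3
  exact ⟨rfl, rfl, (s, t, r), hs, ht, hr⟩

theorem exists_isoClass_eq [IsAlgClosed F] {d : ℕ} (hd : Odd d) (V : ModuleCat.{u} (BI F))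
    [IsSimpleModule (BI F) V] (hdim : Module.finrank F V = d + 1) :
    ∃ (ε ε' : ℤˣ) (a b c : F), (a, b, c) ∈ EP F d ∧
      isoClass (twist ε ε' (E d hd a b c)) = isoClass V := by
  have : FiniteDimensional F V := FiniteDimensional.of_finrank_pos (by omega)
  obtain ⟨ε, ε', a, b, c, h⟩ := exists_hasHighest (V := V) hd hdim
  have hEP : (a, b, c) ∈ EP F d := (mem_EP_iff hd a b c).2
    ⟨fun _ => h.ph_ne_zero h.isIrred hdim, fun _ => (h.neg_left hd).ph_ne_zero h.isIrred hdim⟩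
  have := isSimpleModule_twist_E ε ε' hd hEP
  exact ⟨ε, ε', a, b, c, hEP, isoClass_eq (finrank_twist_E ε ε' d hd a b c) hdim
    (hasHighest_twist_E ε ε' d hd a b c) h⟩

/-- The map from parameters to isomorphism classes of irreducible modules. -/
noncomputable def classMap (d : ℕ) (hd : Odd d) (x : (ℤˣ × ℤˣ) × EPOrbits F d hd) : EM F d :=
  letI := actionEP F d hd
  Quotient.lift (s := MulAction.orbitRel (ℤˣ × ℤˣ × ℤˣ) (EP F d))
    (fun p : EP F d => (⟨isoClass (twist x.1.1 x.1.2 (E d hd p.1.1 p.1.2.1 p.1.2.2)),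
      twist x.1.1 x.1.2 (E d hd p.1.1 p.1.2.1 p.1.2.2), isSimpleModule_twist_E _ _ hd p.2,
      finrank_twist_E _ _ d hd _ _ _, rfl⟩ : EM F d))
    (by
      rintro p q ⟨s, rfl⟩
      exact Subtype.ext (isoClass_twist_E_smul _ _ hd s q.2)) x.2

theorem classMap_bijective [IsAlgClosed F] (d : ℕ) (hd : Odd d) :
    Function.Bijective (classMap (F := F) d hd) := by
  constructor
  · rintro ⟨⟨ε, ε'⟩, o⟩ ⟨⟨η, η'⟩, o'⟩ e
    obtain ⟨p, rfl⟩ := Quotient.exists_rep o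
    obtain ⟨q, rfl⟩ := Quotient.exists_rep o'
    obtain ⟨h1, h2, s, hs⟩ := eq_of_isoClass_twist_E_eq hd p.2 (congrArg Subtype.val e)
    obtain rfl : ε = η := h1
    obtain rfl : ε' = η' := h2
    refine congrArg (Prod.mk _) (Quotient.sound ⟨s, Subtype.ext ?_⟩)
    exact Prod.ext hs.1 (Prod.ext hs.2.1 hs.2.2)
  · rintro ⟨_, V, hV, hdim, rfl⟩
    obtain ⟨ε, ε', a, b, c, h, e⟩ := exists_isoClass_eq hd V hdim
    exact ⟨((ε, ε'), orbit hd ⟨(a, b, c), h⟩), Subtype.ext e⟩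

end EModules

end BI

theorem theorem2p4 (F : Type u) [Field F] [IsAlgClosed F] [CharZero F] (d : ℕ) (hd : Odd d) :
    ∃ Φ : (ℤˣ × ℤˣ) × BI.EPOrbits F d hd → BI.EM F d,
      Function.Bijective Φ ∧
      ∀ (ε ε' : ℤˣ) (a b c : F) (h : (a, b, c) ∈ BI.EP F d),
        (Φ ((ε, ε'), BI.orbit hd ⟨(a, b, c), h⟩) : BI.IsoClasses F) =
          BI.isoClass (BI.twist ε ε' (BI.E d hd a b c)) :=
  ⟨BI.classMap d hd, BI.classMap_bijective d hd, fun _ _ _ _ _ _ => rfl⟩
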